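/- Let $n\in\mathbb N$ and $\gamma>0$. Write elements of $\mathbb R^{n^2}=\mathbb R^n\times\mathbb R^{n(n-1)}$ as $u=(x,z)=((x_i)_i,(z_{ij})_{i\ne j})$, with the maximum norm $\|\cdot\|$. Let $C_\gamma$ be the space of continuous $\varphi:(-\infty,0]\to\mathbb R^{n^2}$ for which $\lim_{s\to-\infty}e^{\gamma s}\varphi(s)$ exists, with the norm $\|\varphi\|_\gamma=\sup_{s\le 0}e^{\gamma s}\|\varphi(s)\|$; for a function $u$ defined on $(-\infty,t]$ let $u_t(s)=u(t+s)$, $s\le 0$. For $i\neq j$ let $c_{ij},d_{ij}\ge 0$ and let $\mu_{ij}$ be a positive Borel measure on $(-\infty,0]$ with $\int_{-\infty}^0e^{-\gamma\tau}\,d\mu_{ij}(\tau)<\infty$; let $\Gamma_i\in\mathbb R$, let $I_i:\mathbb R\to\mathbb R$ be continuous, and let $A_i,B_{ij}:\mathbb R\to\mathbb R$ be locally Lipschitz with $A_i,B_{ij}\ge\alpha$ for some constant $\alpha>0$. Put $[y]^+=\max\{y,0\}$. For $\varepsilon\in(0,1)$ let $\sigma_\varepsilon(s)=1/(1+e^{-s/\varepsilon})$.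 The sigmoidal system $(S_\varepsilon)$, for $t\ge t_0$, is $$x_i'(t)=-A_i(x_i(t))x_i(t)+\sum_{k\ne i}(z_{ki}(t)-c_{ki})\int_{-\infty}^0\sigma_\varepsilon(x_k(t+\tau)-\Gamma_k)\,d\mu_{ki}(\tau)+I_i(t),$$ $$z_{ij}'(t)=-B_{ij}(z_{ij}(t))z_{ij}(t)+d_{ij}\int_{-\infty}^0\sigma_\varepsilon(x_i(t+\tau)-\Gamma_i)\,d\mu_{ij}(\tau)\,[x_j(t)]^+.$$ Let $b(0)=0$ and $b(\varepsilon)=\varepsilon\log\frac{1-\varepsilon}{\varepsilon}$ for $\varepsilon\in(0,1)$, and let $\chi_\varepsilon(s)$ be $[0,\varepsilon]$ if $s<-b(\varepsilon)$, $[0,1]$ if $-b(\varepsilon)\le s\le b(\varepsilon)$, and $[1-\varepsilon,1]$ if $s>b(\varepsilon)$. The $\varepsilon$-inflated inclusion $(H_\varepsilon)$, $\varepsilon\in[0,1)$, is $$u'(t)\in D(u_t)+X^\varepsilon(u_t)+I(t),\qquad t\ge t_0,$$ where $D(u_t)=\big((-A_i(x_i(t))x_i(t))_i,(-B_{ij}(z_{ij}(t))z_{ij}(t))_{i\ne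 j}\big)$, $I(t)=((I_i(t))_i,0)$ and $$X^\varepsilon(u_t)=\prod_i\Big(\sum_{k\ne i}(z_{ki}(t)-c_{ki})\int_{-\infty}^0\chi_\varepsilon(x_k(t+\tau)-\Gamma_k)\,d\mu_{ki}(\tau)\Big)\times\prod_{i\ne j}\Big(d_{ij}[x_j(t)]^+\int_{-\infty}^0\chi_\varepsilon(x_i(t+\tau)-\Gamma_i)\,d\mu_{ij}(\tau)\Big).$$ Here the integrals are Aumann integrals (the set of the integrals of all integrable selectors) and sums and multiples of sets are pointwise. The Heaviside inclusion is $(H_0)$. A solution of $(S_\varepsilon)$ or $(H_\varepsilon)$ on $[t_0,t_0+T]$ with initial datum $\varphi\in C_\gamma$ at $t_0$ is a function $u:(-\infty,t_0+T]\to\mathbb R^{n^2}$ with $u_{t_0}=\varphi$ that is absolutely continuous on $[t_0,t_0+T]$ and satisfies the equation or inclusion for almost every $t\in[t_0,t_0+T]$. Let $t_0\in\mathbb R$ and $T>0$. Then the following hold. 1. Let $r>0$ and let $(\varepsilon_m)_m\subset(0,\frac15]$ decrease to $0$. Let $(u_0^m)_m\subset C_\gamma$ with $\|u_0^m\|_\gamma\le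 r$ converge in $C_\gamma$ to $u_0\in C_\gamma$. For every $m$ let $u^{\varepsilon_m}$ be a solution of $(S_{\varepsilon_m})$ on $[t_0,t_0+T]$ with initial datum $u_0^m$ at $t_0$. Then some subsequence $(u^{\varepsilon_{m_k}})_k$ converges uniformly on $[t_0,t_0+T]$ to some $u^*\in C([t_0,t_0+T],\mathbb R^{n^2})$, and $u^*$, extended to $(-\infty,t_0]$ by $u^*_{t_0}=u_0$, is a solution of the Heaviside inclusion $(H_0)$ on $[t_0,t_0+T]$ with initial datum $u_0$ at $t_0$. 2. For every $\varepsilon\in(0,\frac15]$, every solution of $(S_\varepsilon)$ on $[t_0,t_0+T]$ with initial datum in $C_\gamma$ at $t_0$ is a solution of $(H_\varepsilon)$ on $[t_0,t_0+T]$ with the same initial datum. 3. For every $u_0\in C_\gamma$ the Heaviside inclusion $(H_0)$ has a solution on $[t_0,t_0+T]$ with initial datum $u_0$ at $t_0$. -/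

import Mathlib

open Set Filter Topology MeasureTheory
open scoped Pointwise

noncomputable section

/-- Ordered pairs `(i, j)` with `i ≠ j`. -/
abbrev OffDiag (n : ℕ) : Type := {p : Fin n × Fin n // p.1 ≠ p.2}

/-- The state space `ℝⁿ × ℝ^{n(n-1)} ≃ ℝ^{n²}` of pairs `(x, z)`, with the maximum norm. -/
abbrev NetState (n : ℕ) : Type := (Fin n → ℝ) × (OffDiag n → ℝ)

/-- Functions `(-∞, 0] → ℝ^{n²}`. -/
abbrev NetHistory (n : ℕ) : Type := Iic (0 : ℝ) → NetState n

/-- The history `u_t : (-∞, 0] → ℝ^{n²}`, `s ↦ u (t + s)`.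
It only involves the values of `u` on `(-∞, t]`. -/
def historyAt {n : ℕ} (u : ℝ → NetState n) (t : ℝ) : NetHistory n :=
  fun s => u (t + (s : ℝ))

/-- The phase space `C_γ` of continuous `φ : (-∞, 0] → ℝ^{n²}` for which
`lim_{s → -∞} e^{γ s} φ(s)` exists. -/
def CGamma (n : ℕ) (γ : ℝ) : Set (NetHistory n) :=
  {φ | Continuous φ ∧
    ∃ L : NetState n, Tendsto (fun s : Iic (0 : ℝ) => Real.exp (γ * (s : ℝ)) • φ s) atBot (𝓝 L)}

/-- The norm `‖φ‖_γ = sup_{s ≤ 0} e^{γ s} ‖φ(s)‖`. -/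
def gammaNorm {n : ℕ} (γ : ℝ) (φ : NetHistory n) : ℝ :=
  ⨆ s : Iic (0 : ℝ), Real.exp (γ * (s : ℝ)) * ‖φ s‖

/-- The supremum defining `gammaNorm` is finite on `C_γ`. -/
theorem CGamma.bddAbove {n : ℕ} {γ : ℝ} {φ : NetHistory n} (h : φ ∈ CGamma n γ) :
    BddAbove (range fun s : Iic (0 : ℝ) => Real.exp (γ * (s : ℝ)) * ‖φ s‖) := by
  obtain ⟨hc, L, hL⟩ := h
  have hev := hL.norm.eventually (gt_mem_nhds (lt_add_one ‖L‖))
  obtain ⟨a, ha⟩ := eventually_atBot.1 hev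
  have hcont : Continuous fun s : Iic (0 : ℝ) => Real.exp (γ * (s : ℝ)) * ‖φ s‖ :=
    (Real.continuous_exp.comp (continuous_const.mul continuous_subtype_val)).mul hc.norm
  have hK : IsCompact ((Subtype.val : Iic (0 : ℝ) → ℝ) ⁻¹' Icc (a : ℝ) 0) :=
    isClosed_Iic.isClosedEmbedding_subtypeVal.isCompact_preimage isCompact_Icc
  obtain ⟨M, hM⟩ := hK.bddAbove_image hcont.continuousOn
  refine ⟨max (‖L‖ + 1) M, ?_⟩
  rintro _ ⟨s, rfl⟩
  rcases le_total s a with hs | hs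
  · refine le_max_of_le_left ?_
    have := (ha s hs).le
    rwa [norm_smul, Real.norm_of_nonneg (Real.exp_pos _).le] at this
  · exact le_max_of_le_right (hM ⟨s, ⟨hs, s.2⟩, rfl⟩)

/-- `C_γ` is closed under differences. -/
theorem CGamma.sub_mem {n : ℕ} {γ : ℝ} {φ ψ : NetHistory n} (hφ : φ ∈ CGamma n γ)
    (hψ : ψ ∈ CGamma n γ) : φ - ψ ∈ CGamma n γ := by
  obtain ⟨hc, L, hL⟩ := hφ
  obtain ⟨hc', L', hL'⟩ := hψ
  refine ⟨hc.sub hc', L - L', (hL.sub hL').congr fun s => ?_⟩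
  simp [smul_sub]

/-- The sigmoidal function `σ_ε(x) = 1 / (1 + e^{-x/ε})`, used for `ε > 0`. -/
def sigmoidFun (ε x : ℝ) : ℝ := 1 / (1 + Real.exp (-x / ε))

/-- `b(ε) = ε log((1-ε)/ε)` for `ε ∈ (0, 1)`, and `b(0) = 0`. -/
def bFun (ε : ℝ) : ℝ := if ε = 0 then 0 else ε * Real.log ((1 - ε) / ε)

/-- The inflated Heaviside function `χ_ε`; in particular, `χ_0(s)` is `{0}` for `s < 0`,
`[0, 1]` for `s = 0`, and `{1}` for `s > 0`. -/
def chiSet (ε s : ℝ) : Set ℝ :=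
  if s < -bFun ε then Icc 0 ε
  else if s ≤ bFun ε then Icc 0 1
  else Icc (1 - ε) 1

/-- The Aumann integral of `F` with respect to `μ`: the set of the integrals of all
`μ`-integrable selectors of `F`. -/
def aumannIntegral {α : Type*} [MeasurableSpace α] (F : α → Set ℝ) (μ : Measure α) : Set ℝ :=
  {y | ∃ s : α → ℝ, (∀ a, s a ∈ F a) ∧ Integrable s μ ∧ ∫ a, s a ∂μ = y}

/-- The data of the neural network: decay coefficients `A_i`, `B_ij`, constants `c_ij, d_ij ≥ 0`,
thresholds `Γ_i`, positive Borel measures `μ_ij` on `(-∞, 0]`, and stimuli `I_i`. -/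
structure NeuralNet (n : ℕ) where
  A : Fin n → ℝ → ℝ
  B : OffDiag n → ℝ → ℝ
  c : OffDiag n → ℝ
  d : OffDiag n → ℝ
  Γ : Fin n → ℝ
  μ : OffDiag n → Measure (Iic (0 : ℝ))
  I : Fin n → ℝ → ℝ
  c_nonneg : ∀ p, 0 ≤ c p
  d_nonneg : ∀ p, 0 ≤ d p

namespace NeuralNet

variable {n : ℕ}

/-- `A_i`, `B_ij` are locally Lipschitz and bounded below by a common positive constant. -/
def HypD (N : NeuralNet n) : Prop :=
  (∀ i, LocallyLipschitz (N.A i)) ∧ (∀ p, LocallyLipschitz (N.B p)) ∧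
    ∃ α : ℝ, 0 < α ∧ (∀ i s, α ≤ N.A i s) ∧ (∀ p s, α ≤ N.B p s)

/-- `∫ e^{-γ τ} dμ_ij(τ) < ∞`. -/
def HypM (N : NeuralNet n) (γ : ℝ) : Prop :=
  ∀ p, ∫⁻ τ, ENNReal.ofReal (Real.exp (-γ * (τ : ℝ))) ∂(N.μ p) < ⊤

/-- The stimuli are continuous. -/
def HypI (N : NeuralNet n) : Prop := ∀ i, Continuous (N.I i)

/-- The decay term, as a function of the present state `(x, z) = u_t(0)`. -/
def decay (N : NeuralNet n) (φ : NetHistory n) : NetState n :=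
  let v := φ ⟨0, le_refl (0 : ℝ)⟩
  (fun i => -N.A i (v.1 i) * v.1 i, fun p => -N.B p (v.2 p) * v.2 p)

/-- The stimuli term `((I_i(t))_i, 0)`. -/
def stimuli (N : NeuralNet n) (t : ℝ) : NetState n := (fun i => N.I i t, 0)

/-- The sigmoidal signal `∫ σ_ε(x_i(τ) - Γ_i) dμ_ij(τ)`, where `p = (i, j)`. -/
def sigSignal (N : NeuralNet n) (ε : ℝ) (φ : NetHistory n) (p : OffDiag n) : ℝ :=
  ∫ τ, sigmoidFun ε ((φ τ).1 p.1.1 - N.Γ p.1.1) ∂(N.μ p)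

/-- The set-valued signal `∫ χ_ε(x_i(τ) - Γ_i) dμ_ij(τ)` (Aumann integral), `p = (i, j)`. -/
def chiSignal (N : NeuralNet n) (ε : ℝ) (φ : NetHistory n) (p : OffDiag n) : Set ℝ :=
  aumannIntegral (fun τ => chiSet ε ((φ τ).1 p.1.1 - N.Γ p.1.1)) (N.μ p)

/-- The excitation and inhibition term `Σ^ε` of the sigmoidal system. -/
def sigTerm (N : NeuralNet n) (ε : ℝ) (φ : NetHistory n) : NetState n :=
  let v := φ ⟨0, le_refl (0 : ℝ)⟩
  (fun i => ∑ k : {k : Fin n // k ≠ i},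
      (v.2 ⟨(k.1, i), k.2⟩ - N.c ⟨(k.1, i), k.2⟩) * N.sigSignal ε φ ⟨(k.1, i), k.2⟩,
    fun p => N.d p * N.sigSignal ε φ p * max (v.1 p.1.2) 0)

/-- The set-valued term `X^ε`: a product over all coordinates, the sums and multiples being
the pointwise (Minkowski) ones. -/
def chiTerm (N : NeuralNet n) (ε : ℝ) (φ : NetHistory n) : Set (NetState n) :=
  let v := φ ⟨0, le_refl (0 : ℝ)⟩
  {w | (∀ i, w.1 i ∈ ∑ k : {k : Fin n // k ≠ i},
      (v.2 ⟨(k.1, i), k.2⟩ - N.c ⟨(k.1, i), k.2⟩) • N.chiSignal ε φ ⟨(k.1, i), k.2⟩) ∧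
    ∀ p, w.2 p ∈ (N.d p * max (v.1 p.1.2) 0) • N.chiSignal ε φ p}

/-- `u` solves the sigmoidal system on `[t₀, t₀ + T]` with initial datum `φ` at `t₀`: it is
absolutely continuous there and satisfies the equation almost everywhere. (Classical solutions
are of this kind.) Only the values of `u` on `(-∞, t₀ + T]` matter. -/
def IsSigmoidalSolution (N : NeuralNet n) (ε t₀ T : ℝ) (φ : NetHistory n)
    (u : ℝ → NetState n) : Prop :=
  historyAt u t₀ = φ ∧ AbsolutelyContinuousOnInterval u t₀ (t₀ + T) ∧
    ∀ᵐ t ∂volume.restrict (Icc t₀ (t₀ + T)),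
      HasDerivAt u (N.decay (historyAt u t) + N.sigTerm ε (historyAt u t) + N.stimuli t) t

/-- `u` solves the `ε`-inflated inclusion `u'(t) ∈ D(u_t) + X^ε(u_t) + I(t)` on `[t₀, t₀ + T]`
with initial datum `φ` at `t₀`: it is absolutely continuous there and satisfies the inclusion
almost everywhere. The Heaviside inclusion is the case `ε = 0`. -/
def IsInflatedSolution (N : NeuralNet n) (ε t₀ T : ℝ) (φ : NetHistory n)
    (u : ℝ → NetState n) : Prop :=
  historyAt u t₀ = φ ∧ AbsolutelyContinuousOnInterval u t₀ (t₀ + T) ∧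
    ∀ᵐ t ∂volume.restrict (Icc t₀ (t₀ + T)),
      ∃ w ∈ N.chiTerm ε (historyAt u t),
        HasDerivAt u (N.decay (historyAt u t) + w + N.stimuli t) t

end NeuralNet

end

/-!
Right-hand sides of the sigmoidal systems depend on `ε`, but two facts do not: `σ_ε` takes values
in `[0, 1]`, and the decay terms point towards the origin. Hence the signals are bounded by the
total masses of the measures, the remaining terms grow at most linearly in the state, and Grönwall's
inequality for `1 + ∑ u_q²` bounds all solutions with bounded initial data, uniformly in `ε`
(`NeuralNet.exists_apriori_bound`). So the solutions are uniformly Lipschitz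
(`NeuralNet.exists_lipschitz_bound`), and the Arzelà-Ascoli theorem provides a subsequence that
converges uniformly to a Lipschitz function `w`, which is differentiable almost everywhere.

That `w` solves the Heaviside inclusion is shown without weak compactness of the derivatives. The
coordinates of the set-valued right-hand side are intervals, so only one-sided bounds on the
coordinates of `w'(t)` are needed. By dominated convergence, the integrals of `σ_ε(x_m(s + ·))`
are, for `s → t`, `ε → 0` and `m → ∞`, asymptotically between the integrals of the indicators of
`{w > Γ}` and `{w ≥ Γ}` (`exists_bounds_integral_sigmoidFun`), and the interval between these lies
in the Aumann integral of `χ_0`. Bounds on the derivatives that hold near `t` and for large `m`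
pass to the derivative of the limit at `t` (`le_of_hasDerivAt_of_tendsto_of_ae_deriv`).

That sigmoidal solutions solve the inflated inclusion is the pointwise fact `σ_ε(s) ∈ χ_ε(s)`.

For the existence statement, the sigmoidal systems are solved by a contraction argument after
truncation of the state at the radius of the a priori bound, which makes the right-hand side
globally Lipschitz (`NeuralNet.exists_isSigmoidalSolution`); then the convergence result applies
with constant initial data.
-/

/-! ### Absolutely continuous functions -/

/-- Absolute continuity is preserved by Lipschitz maps. -/
theorem AbsolutelyContinuousOnInterval.lipschitz_comp {X Y : Type*} [PseudoMetricSpace X]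
    [PseudoMetricSpace Y] {f : ℝ → X} {a b : ℝ} (hf : AbsolutelyContinuousOnInterval f a b)
    {g : X → Y} {K : NNReal} (hg : LipschitzWith K g) :
    AbsolutelyContinuousOnInterval (fun t => g (f t)) a b := by
  refine squeeze_zero (fun E => Finset.sum_nonneg fun i _ => dist_nonneg) (fun E => ?_)
    (by simpa using Tendsto.const_mul (K : ℝ) hf)
  rw [Finset.mul_sum]
  exact Finset.sum_le_sum fun i _ => hg.dist_le_mul _ _

theorem AbsolutelyContinuousOnInterval.finset_sum {ι : Type*} (s : Finset ι) {f : ι → ℝ → ℝ}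
    {a b : ℝ} (hf : ∀ i ∈ s, AbsolutelyContinuousOnInterval (f i) a b) :
    AbsolutelyContinuousOnInterval (fun t => ∑ i ∈ s, f i t) a b := by
  classical
  induction s using Finset.induction_on with
  | empty =>
    have h0 : LipschitzOnWith 0 (fun _ : ℝ => (0 : ℝ)) (uIcc a b) :=
      (LipschitzWith.const (0 : ℝ)).lipschitzOnWith
    simpa using h0.absolutelyContinuousOnInterval
  | insert i s hi ih =>
    simp only [Finset.sum_insert hi]
    exact (hf i (Finset.mem_insert_self i s)).fun_add
      (ih fun j hj => hf j (Finset.mem_insert_of_mem hj))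

/-- Mean value inequality for absolutely continuous functions. -/
theorem AbsolutelyContinuousOnInterval.sub_le_of_ae_deriv_le {f : ℝ → ℝ} {a b M : ℝ}
    (hab : a ≤ b) (hf : AbsolutelyContinuousOnInterval f a b)
    (h : ∀ᵐ t ∂volume.restrict (Icc a b), ∃ f', HasDerivAt f f' t ∧ f' ≤ M) :
    f b - f a ≤ M * (b - a) := by
  rw [← hf.integral_deriv_eq_sub]
  have h2 : ∫ _t in a..b, M = M * (b - a) := by simp [mul_comm]
  rw [← h2]
  refine intervalIntegral.integral_mono_ae_restrict hab hf.intervalIntegrable_deriv (by simp) ?_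
  filter_upwards [h] with t ht
  obtain ⟨f', h1, h2⟩ := ht
  rwa [h1.deriv]

/-- Grönwall's inequality for absolutely continuous functions. -/
theorem AbsolutelyContinuousOnInterval.le_exp_of_ae_deriv_le_mul {V : ℝ → ℝ} {a b K : ℝ}
    (hab : a ≤ b) (hV : AbsolutelyContinuousOnInterval V a b)
    (h : ∀ᵐ t ∂volume.restrict (Icc a b), ∃ V', HasDerivAt V V' t ∧ V' ≤ K * V t) :
    V b ≤ V a * Real.exp (K * (b - a)) := by
  have hexp : AbsolutelyContinuousOnInterval (fun t => Real.exp (-K * (t - a))) a b :=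
    ContDiffOn.absolutelyContinuousOnInterval (by fun_prop)
  have key := (hV.fun_mul hexp).sub_le_of_ae_deriv_le (M := 0) hab (by
    filter_upwards [h] with t ⟨V', h1, h2⟩
    have hd : HasDerivAt (fun t => Real.exp (-K * (t - a)))
        (Real.exp (-K * (t - a)) * (-K * 1)) t :=
      (((hasDerivAt_id t).sub_const a).const_mul (-K)).exp
    refine ⟨_, h1.mul hd, ?_⟩
    have : V' * Real.exp (-K * (t - a)) + V t * (Real.exp (-K * (t - a)) * (-K * 1))
        = (V' - K * V t) * Real.exp (-K * (t - a)) := by ring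
    rw [this]
    exact mul_nonpos_of_nonpos_of_nonneg (by linarith) (Real.exp_pos _).le)
  simp only [sub_self, mul_zero, Real.exp_zero, mul_one, zero_mul, sub_nonpos] at key
  calc V b = V b * Real.exp (-K * (b - a)) * Real.exp (K * (b - a)) := by
        rw [mul_assoc, ← Real.exp_add]; simp
    _ ≤ _ := by gcongr

/-- A one-sided bound on the derivatives of absolutely continuous functions, valid near `t`, passes
to the derivative at `t` of their pointwise limit. -/
theorem le_of_hasDerivAt_of_tendsto_of_ae_deriv {f : ℕ → ℝ → ℝ} {f₀ : ℝ → ℝ} {G : ℕ → ℝ → ℝ}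
    {a b t f' U : ℝ} (ht : t ∈ Ioo a b) (hf : ∀ m, AbsolutelyContinuousOnInterval (f m) a b)
    (hG : ∀ m, ∀ᵐ s ∂volume.restrict (Icc a b), HasDerivAt (f m) (G m s) s)
    (hlim : ∀ s ∈ Icc a b, Tendsto (fun m => f m s) atTop (𝓝 (f₀ s)))
    (hf₀ : HasDerivAt f₀ f' t)
    (hU : ∀ η > 0, ∀ᶠ q : ℕ × ℝ in atTop ×ˢ 𝓝 t, G q.1 q.2 ≤ U + η) : f' ≤ U := by
  refine le_of_forall_pos_le_add fun η hη => ?_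
  obtain ⟨P, hP, Q, hQ, hPQ⟩ := eventually_prod_iff.1 (hU η hη)
  obtain ⟨δ, hδ, hQ⟩ := Metric.eventually_nhds_iff.1 hQ
  have hslope : Tendsto (slope f₀ t) (𝓝[>] t) (𝓝 f') :=
    (hasDerivWithinAt_iff_tendsto_slope' (by simp)).1 hf₀.hasDerivWithinAt
  refine le_of_tendsto hslope ?_
  filter_upwards [Ioo_mem_nhdsGT (show t < min b (t + δ) from lt_min ht.2 (by linarith))] with s hs
  have hsb : s < b := hs.2.trans_le (min_le_left _ _)
  have hsδ : s < t + δ := hs.2.trans_le (min_le_right _ _)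
  have hts : t < s := hs.1
  have hsub : Icc t s ⊆ Icc a b := Icc_subset_Icc ht.1.le hsb.le
  have hle : f₀ s - f₀ t ≤ (U + η) * (s - t) := by
    refine le_of_tendsto ((hlim s ⟨ht.1.le.trans hts.le, hsb.le⟩).sub
      (hlim t ⟨ht.1.le, ht.2.le⟩)) ?_
    filter_upwards [hP] with m hm
    refine ((hf m).mono ?_).sub_le_of_ae_deriv_le hts.le ?_
    · rwa [uIcc_of_le hts.le, uIcc_of_le (ht.1.trans ht.2).le]
    · filter_upwards [ae_restrict_of_ae_restrict_of_subset hsub (hG m),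
        ae_restrict_mem measurableSet_Icc] with r hr hrm
      refine ⟨_, hr, hPQ hm (hQ ?_)⟩
      rw [Real.dist_eq, abs_of_nonneg (by linarith [hrm.1])]
      linarith [hrm.2]
  rw [slope_def_field, div_le_iff₀ (by linarith)]
  exact hle

/-! ### Functional differential equations with Lipschitz right-hand side -/

/-- Picard's theorem for a nonanticipative functional differential equation `u'(t) = F(t, u)`:
`F(t, u)` may depend on all values of `u` on `(-∞, t]`. The unknown of the contraction is the
function `s ↦ e^{-λ (s - t₀)} F(s, u)`, in the supremum norm; the weight makes the contraction
global on `[t₀, t₁]`. -/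
theorem exists_solution_of_lipschitz_functional {E : Type*} [NormedAddCommGroup E]
    [NormedSpace ℝ E] [CompleteSpace E] {t₀ t₁ : ℝ} (h01 : t₀ ≤ t₁) {F : ℝ → (ℝ → E) → E} {L : ℝ}
    (hL : 0 ≤ L) (hcont : ∀ u : ℝ → E, Continuous u → Continuous fun s => F s u)
    (hlip : ∀ s ∈ Icc t₀ t₁, ∀ u v : ℝ → E, Continuous u → Continuous v → ∀ δ : ℝ,
      (∀ r ≤ s, ‖u r - v r‖ ≤ δ) → ‖F s u - F s v‖ ≤ L * δ)
    {φ : ℝ → E} (hφ : Continuous φ) :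
    ∃ u : ℝ → E, Continuous u ∧ (∀ t ≤ t₀, u t = φ t) ∧
      ∀ t ∈ Icc t₀ t₁, HasDerivWithinAt u (F t u) (Icc t₀ t₁) t := by
  set lam : ℝ := L + 1 with hlam
  have hlam0 : 0 < lam := by positivity
  -- the path with weighted derivative `g`
  let U : C(Icc t₀ t₁, E) → ℝ → E := fun g t =>
    φ (min t t₀) + ∫ r in t₀..max t t₀, Real.exp (lam * (r - t₀)) • IccExtend h01 g r
  have hint : ∀ g : C(Icc t₀ t₁, E),
      Continuous fun r => Real.exp (lam * (r - t₀)) • IccExtend h01 g r := fun g =>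
    (by fun_prop : Continuous fun r : ℝ => Real.exp (lam * (r - t₀))).smul
      (g.continuous.Icc_extend')
  have hU : ∀ g, Continuous (U g) := fun g => by
    refine (hφ.comp (continuous_id.min continuous_const)).add ?_
    exact (intervalIntegral.continuous_primitive (fun a b => (hint g).intervalIntegrable a b)
      t₀).comp (continuous_id.max continuous_const)
  have hdiff : ∀ g₁ g₂ : C(Icc t₀ t₁, E), ∀ s, t₀ ≤ s → ∀ r ≤ s,
      ‖U g₁ r - U g₂ r‖ ≤ dist g₁ g₂ * (Real.exp (lam * (s - t₀)) / lam) := by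
    intro g₁ g₂ s hs r hr
    have hd : ∀ x : ℝ, HasDerivAt (fun x => Real.exp (lam * (x - t₀)) / lam)
        (Real.exp (lam * (x - t₀))) x := fun x => by
      have := ((((hasDerivAt_id x).sub_const t₀).const_mul lam).exp).div_const lam
      simpa [hlam0.ne'] using this
    have hm : t₀ ≤ max r t₀ := le_max_right _ _
    have : U g₁ r - U g₂ r = ∫ x in t₀..max r t₀, (Real.exp (lam * (x - t₀)) • IccExtend h01 g₁ x
        - Real.exp (lam * (x - t₀)) • IccExtend h01 g₂ x) := by
      rw [intervalIntegral.integral_sub ((hint g₁).intervalIntegrable _ _)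
        ((hint g₂).intervalIntegrable _ _)]
      simp only [U]; abel
    rw [this]
    calc _ ≤ ∫ x in t₀..max r t₀, dist g₁ g₂ * Real.exp (lam * (x - t₀)) := by
          refine intervalIntegral.norm_integral_le_of_norm_le hm (ae_of_all _ fun x _ => ?_)
            (Continuous.intervalIntegrable (by fun_prop) _ _)
          rw [← smul_sub, norm_smul, Real.norm_of_nonneg (Real.exp_pos _).le, mul_comm]
          gcongr
          rw [← dist_eq_norm]
          exact ContinuousMap.dist_apply_le_dist _
      _ = dist g₁ g₂ * (Real.exp (lam * (max r t₀ - t₀)) / lam - 1 / lam) := by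
          rw [intervalIntegral.integral_const_mul,
            intervalIntegral.integral_eq_sub_of_hasDerivAt (fun x _ => hd x)
              (Continuous.intervalIntegrable (by fun_prop) _ _)]
          simp
      _ ≤ _ := by
          have : Real.exp (lam * (max r t₀ - t₀)) ≤ Real.exp (lam * (s - t₀)) := by
            gcongr; exact max_le hr hs
          gcongr
          have h1 : 0 ≤ 1 / lam := by positivity
          have h2 : Real.exp (lam * (max r t₀ - t₀)) / lam ≤ Real.exp (lam * (s - t₀)) / lam := by
            gcongr
          linarith
  let Ψ : C(Icc t₀ t₁, E) → C(Icc t₀ t₁, E) := fun g =>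
    ⟨fun s => Real.exp (-(lam * ((s : ℝ) - t₀))) • F s (U g),
      (by fun_prop : Continuous fun s : Icc t₀ t₁ => Real.exp (-(lam * ((s : ℝ) - t₀)))).smul
        ((hcont _ (hU g)).comp continuous_subtype_val)⟩
  have hΨ : ContractingWith (L / lam).toNNReal Ψ := by
    refine ⟨?_, LipschitzWith.of_dist_le_mul fun g₁ g₂ => ?_⟩
    · rw [Real.toNNReal_lt_one, div_lt_one hlam0]; linarith
    · rw [Real.coe_toNNReal _ (by positivity)]
      refine (ContinuousMap.dist_le (by positivity)).2 fun s => ?_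
      rw [dist_eq_norm]
      change ‖Real.exp (-(lam * ((s : ℝ) - t₀))) • F s (U g₁)
        - Real.exp (-(lam * ((s : ℝ) - t₀))) • F s (U g₂)‖ ≤ _
      rw [← smul_sub, norm_smul, Real.norm_of_nonneg (Real.exp_pos _).le]
      have := hlip s s.2 _ _ (hU g₁) (hU g₂) _ (hdiff g₁ g₂ s s.2.1)
      calc _ ≤ Real.exp (-(lam * ((s : ℝ) - t₀))) *
            (L * (dist g₁ g₂ * (Real.exp (lam * ((s : ℝ) - t₀)) / lam))) := by gcongr
        _ = L / lam * dist g₁ g₂ * (Real.exp (-(lam * ((s : ℝ) - t₀))) *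
            Real.exp (lam * ((s : ℝ) - t₀))) := by ring
        _ = _ := by rw [← Real.exp_add]; simp
  obtain ⟨g, hg⟩ : ∃ g, Ψ g = g := ⟨_, hΨ.fixedPoint_isFixedPt⟩
  refine ⟨U g, hU g, fun t ht => by simp [U, ht], fun t ht => ?_⟩
  have hval : Real.exp (lam * (t - t₀)) • IccExtend h01 g t = F t (U g) := by
    rw [IccExtend_of_mem h01 _ ht]
    have : g ⟨t, ht⟩ = Real.exp (-(lam * (t - t₀))) • F t (U g) := by
      conv_lhs => rw [← hg]
      rfl
    rw [this, smul_smul, ← Real.exp_add]; simp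
  rw [← hval]
  have hder := ((hint g).integral_hasStrictDerivAt t₀ t).hasDerivAt.const_add (φ t₀)
  refine hder.hasDerivWithinAt.congr (fun s hs => ?_) ?_
  · simp [U, hs.1]
  · simp [U, ht.1]

/-! ### Intervals and Aumann integrals -/

/-- A real number between the sums of the end points of the intervals `a_k • [l_k, h_k]` lies in
their Minkowski sum. -/
theorem mem_sum_smul_of_mem_Icc {κ : Type*} [Fintype κ] {a l h : κ → ℝ} {S : κ → Set ℝ}
    (hlh : ∀ k, l k ≤ h k) (hS : ∀ k, Icc (l k) (h k) ⊆ S k) {y : ℝ}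
    (hy₁ : ∑ k, min (a k * l k) (a k * h k) ≤ y) (hy₂ : y ≤ ∑ k, max (a k * l k) (a k * h k)) :
    y ∈ ∑ k, a k • S k := by
  rw [Set.mem_fintype_sum]
  -- all summands are taken at the same relative position `θ` in their intervals
  have hc : ContinuousOn (fun θ : ℝ => ∑ k, ((1 - θ) * min (a k * l k) (a k * h k)
      + θ * max (a k * l k) (a k * h k))) (Icc 0 1) := by fun_prop
  obtain ⟨θ, ⟨h0, h1⟩, hθ⟩ := intermediate_value_Icc zero_le_one hc
    (show y ∈ Icc _ _ by constructor <;> simpa using ‹_›)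
  refine ⟨_, fun k => ?_, hθ⟩
  rw [Set.mem_smul_set]
  have h1' : 0 ≤ 1 - θ := by linarith
  rcases le_total (a k * l k) (a k * h k) with hle | hle
  · refine ⟨(1 - θ) * l k + θ * h k, hS k ⟨?_, ?_⟩, ?_⟩
    · nlinarith [hlh k]
    · nlinarith [hlh k]
    · rw [min_eq_left hle, max_eq_right hle, smul_eq_mul]; ring
  · refine ⟨(1 - θ) * h k + θ * l k, hS k ⟨?_, ?_⟩, ?_⟩
    · nlinarith [hlh k]
    · nlinarith [hlh k]
    · rw [min_eq_right hle, max_eq_left hle, smul_eq_mul]; ring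

/-- The Aumann integral of the set-valued Heaviside function contains the interval between the
integrals of its lower and its upper selector. -/
theorem Icc_subset_aumannIntegral_chiSet_zero {α : Type*} [MeasurableSpace α] {μ : Measure α}
    [IsFiniteMeasure μ] {x : α → ℝ} (hx : Measurable x) :
    Icc (∫ a, (if 0 < x a then (1 : ℝ) else 0) ∂μ) (∫ a, (if 0 ≤ x a then (1 : ℝ) else 0) ∂μ) ⊆
      aumannIntegral (fun a => chiSet 0 (x a)) μ := by
  intro y hy
  have hint : ∀ p : α → Prop, [DecidablePred p] → MeasurableSet {a | p a} →
      Integrable (fun a => if p a then (1 : ℝ) else 0) μ := fun p _ hp =>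
    Integrable.of_bound (Measurable.ite hp measurable_const measurable_const).aestronglyMeasurable
      1 (ae_of_all _ fun a => by split_ifs <;> simp)
  have hlo := hint (fun a => 0 < x a) (measurableSet_lt measurable_const hx)
  have hhi := hint (fun a => 0 ≤ x a) (measurableSet_le measurable_const hx)
  have hc : ContinuousOn (fun θ : ℝ => (1 - θ) * (∫ a, (if 0 < x a then (1 : ℝ) else 0) ∂μ)
      + θ * ∫ a, (if 0 ≤ x a then (1 : ℝ) else 0) ∂μ) (Icc 0 1) := by fun_prop
  obtain ⟨θ, ⟨h0, h1⟩, hθ⟩ := intermediate_value_Icc zero_le_one hc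
    (show y ∈ Icc _ _ by simpa using hy)
  refine ⟨fun a => (1 - θ) * (if 0 < x a then (1 : ℝ) else 0)
    + θ * (if 0 ≤ x a then (1 : ℝ) else 0), fun a => ?_,
    (hlo.const_mul _).add (hhi.const_mul _), ?_⟩
  · rcases lt_trichotomy (x a) 0 with h | h | h
    · simp [chiSet, bFun, h, h.not_gt, h.not_ge]
    · simp [chiSet, bFun, h, h0, h1]
    · simp [chiSet, bFun, h, h.not_gt, h.not_ge, h.le]
  · rw [integral_add (hlo.const_mul _) (hhi.const_mul _), integral_const_mul, integral_const_mul]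
    exact hθ

/-! ### The sigmoidal function -/

theorem sigmoidFun_eq (ε x : ℝ) : sigmoidFun ε x = Real.sigmoid (x / ε) := by
  rw [sigmoidFun, Real.sigmoid_def, one_div, neg_div]

theorem sigmoidFun_nonneg (ε x : ℝ) : 0 ≤ sigmoidFun ε x := by
  rw [sigmoidFun_eq]; exact Real.sigmoid_nonneg _

theorem sigmoidFun_le_one (ε x : ℝ) : sigmoidFun ε x ≤ 1 := by
  rw [sigmoidFun_eq]; exact Real.sigmoid_le_one _

theorem norm_sigmoidFun_le_one (ε x : ℝ) : ‖sigmoidFun ε x‖ ≤ 1 := by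
  rw [Real.norm_of_nonneg (sigmoidFun_nonneg ε x)]; exact sigmoidFun_le_one ε x

theorem continuous_sigmoidFun (ε : ℝ) : Continuous (sigmoidFun ε) := by
  have : sigmoidFun ε = fun x => Real.sigmoid (x / ε) := funext (sigmoidFun_eq ε)
  rw [this]
  exact _root_.continuous_sigmoid.comp (continuous_id.div_const ε)

theorem abs_sigmoid_sub_le (x y : ℝ) : |Real.sigmoid x - Real.sigmoid y| ≤ |x - y| := by
  have h := Convex.norm_image_sub_le_of_norm_hasDerivWithin_le (f := Real.sigmoid) (s := univ)
    (C := 1) (fun z _ => (Real.hasDerivAt_sigmoid z).hasDerivWithinAt) (fun z _ => by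
      have h0 := Real.sigmoid_nonneg z
      have h1 := Real.sigmoid_le_one z
      rw [Real.norm_of_nonneg (mul_nonneg h0 (by linarith))]
      nlinarith) convex_univ (mem_univ y) (mem_univ x)
  simpa using h

theorem abs_sigmoidFun_sub_le {ε : ℝ} (hε : 0 < ε) (x y : ℝ) :
    |sigmoidFun ε x - sigmoidFun ε y| ≤ ε⁻¹ * |x - y| := by
  rw [sigmoidFun_eq, sigmoidFun_eq]
  refine (abs_sigmoid_sub_le _ _).trans_eq ?_
  rw [← sub_div, abs_div, abs_of_pos hε, div_eq_inv_mul]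

theorem sigmoidFun_mem_chiSet {ε : ℝ} (hε : 0 < ε) (hε1 : ε < 1) (x : ℝ) :
    sigmoidFun ε x ∈ chiSet ε x := by
  have hq : 0 < (1 - ε) / ε := div_pos (by linarith) hε
  rw [chiSet, bFun, if_neg hε.ne']
  split_ifs with h1 h2
  · refine ⟨sigmoidFun_nonneg _ _, ?_⟩
    have : (1 - ε) / ε ≤ Real.exp (-x / ε) := by
      rw [← Real.log_le_iff_le_exp hq, le_div_iff₀ hε]; linarith
    rw [sigmoidFun, div_le_iff₀ (by positivity)]
    rw [div_le_iff₀ hε] at this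
    linarith
  · exact ⟨sigmoidFun_nonneg _ _, sigmoidFun_le_one _ _⟩
  · refine ⟨?_, sigmoidFun_le_one _ _⟩
    have : Real.exp (-x / ε) ≤ ε / (1 - ε) := by
      rw [← inv_div (1 - ε) ε, ← Real.exp_log hq, ← Real.exp_neg, Real.exp_le_exp, div_le_iff₀ hε]
      linarith
    rw [sigmoidFun, le_div_iff₀ (by positivity)]
    rw [le_div_iff₀ (by linarith)] at this
    linarith

/-- As `ε → 0+` and `x_i → x` pointwise, the integrals of `σ_ε ∘ x_i` are asymptotically between
those of the indicators of `{x > 0}` and `{x ≥ 0}`. -/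
theorem exists_bounds_integral_sigmoidFun {α ι : Type*} [MeasurableSpace α] {μ : Measure α}
    [IsFiniteMeasure μ] {l : Filter ι} [l.IsCountablyGenerated] {ε : ι → ℝ}
    (hε : Tendsto ε l (𝓝[>] 0)) {x : ι → α → ℝ} {x₀ : α → ℝ} (hx : ∀ᶠ i in l, Measurable (x i))
    (hx₀ : Measurable x₀) (hlim : ∀ a, Tendsto (fun i => x i a) l (𝓝 (x₀ a))) :
    ∃ lo hi : ι → ℝ, Tendsto lo l (𝓝 (∫ a, (if 0 < x₀ a then (1 : ℝ) else 0) ∂μ)) ∧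
      Tendsto hi l (𝓝 (∫ a, (if 0 ≤ x₀ a then (1 : ℝ) else 0) ∂μ)) ∧
      ∀ᶠ i in l, lo i ≤ ∫ a, sigmoidFun (ε i) (x i a) ∂μ ∧
        ∫ a, sigmoidFun (ε i) (x i a) ∂μ ≤ hi i := by
  have hmlo : Measurable fun a => if 0 < x₀ a then (1 : ℝ) else 0 :=
    Measurable.ite (measurableSet_lt measurable_const hx₀) measurable_const measurable_const
  have hmhi : Measurable fun a => if 0 ≤ x₀ a then (1 : ℝ) else 0 :=
    Measurable.ite (measurableSet_le measurable_const hx₀) measurable_const measurable_const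
  have hεinv : Tendsto (fun i => (ε i)⁻¹) l atTop := tendsto_inv_nhdsGT_zero.comp hε
  have hone : ∀ a, 0 < x₀ a → Tendsto (fun i => sigmoidFun (ε i) (x i a)) l (𝓝 1) := by
    intro a ha
    simp only [sigmoidFun_eq, div_eq_mul_inv]
    exact Real.tendsto_sigmoid_atTop.comp ((hlim a).pos_mul_atTop ha hεinv)
  have hzero : ∀ a, x₀ a < 0 → Tendsto (fun i => sigmoidFun (ε i) (x i a)) l (𝓝 0) := by
    intro a ha
    simp only [sigmoidFun_eq, div_eq_mul_inv]
    exact Real.tendsto_sigmoid_atBot.comp ((hlim a).neg_mul_atTop ha hεinv)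
  have hms : ∀ᶠ i in l, Measurable fun a => sigmoidFun (ε i) (x i a) := by
    filter_upwards [hx] with i hi
    exact (continuous_sigmoidFun _).measurable.comp hi
  have hint : ∀ {f : α → ℝ}, Measurable f → (∀ a, 0 ≤ f a ∧ f a ≤ 1) → Integrable f μ :=
    fun hf h => Integrable.of_bound hf.aestronglyMeasurable 1 (ae_of_all _ fun a => by
      rw [Real.norm_of_nonneg (h a).1]; exact (h a).2)
  have hσ := fun i a => And.intro (sigmoidFun_nonneg (ε i) (x i a))
    (sigmoidFun_le_one (ε i) (x i a))
  have hlo01 : ∀ a, 0 ≤ (if 0 < x₀ a then (1 : ℝ) else 0) ∧ (if 0 < x₀ a then (1 : ℝ) else 0) ≤ 1 :=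
    fun a => by split_ifs <;> simp
  have hhi01 : ∀ a, 0 ≤ (if 0 ≤ x₀ a then (1 : ℝ) else 0) ∧ (if 0 ≤ x₀ a then (1 : ℝ) else 0) ≤ 1 :=
    fun a => by split_ifs <;> simp
  -- truncating by the indicators gives pointwise convergence also where `x₀ = 0`
  refine ⟨fun i => ∫ a, min (sigmoidFun (ε i) (x i a)) (if 0 < x₀ a then (1 : ℝ) else 0) ∂μ,
    fun i => ∫ a, max (sigmoidFun (ε i) (x i a)) (if 0 ≤ x₀ a then (1 : ℝ) else 0) ∂μ, ?_, ?_, ?_⟩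
  · refine tendsto_integral_filter_of_dominated_convergence (fun _ => 1)
      (hms.mono fun i hi => (hi.min hmlo).aestronglyMeasurable)
      (Eventually.of_forall fun i => ae_of_all _ fun a => ?_) (integrable_const _)
      (ae_of_all _ fun a => ?_)
    · rw [Real.norm_of_nonneg (le_min (hσ i a).1 (hlo01 a).1)]
      exact (min_le_left _ _).trans (hσ i a).2
    · split_ifs with h
      · simpa using (hone a h).min (tendsto_const_nhds (x := (1 : ℝ)))
      · simp only [min_eq_right (hσ _ a).1]
        exact tendsto_const_nhds
  · refine tendsto_integral_filter_of_dominated_convergence (fun _ => 1)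
      (hms.mono fun i hi => (hi.max hmhi).aestronglyMeasurable)
      (Eventually.of_forall fun i => ae_of_all _ fun a => ?_) (integrable_const _)
      (ae_of_all _ fun a => ?_)
    · rw [Real.norm_of_nonneg ((hσ i a).1.trans (le_max_left _ _))]
      exact max_le (hσ i a).2 (hhi01 a).2
    · split_ifs with h
      · simp only [max_eq_right (hσ _ a).2]
        exact tendsto_const_nhds
      · simpa using (hzero a (not_le.1 h)).max (tendsto_const_nhds (x := (0 : ℝ)))
  · filter_upwards [hms] with i hi
    refine ⟨integral_mono (hint (hi.min hmlo) fun a => ⟨le_min (hσ i a).1 (hlo01 a).1,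
        (min_le_left _ _).trans (hσ i a).2⟩) (hint hi (hσ i)) fun a => min_le_left _ _,
      integral_mono (hint hi (hσ i)) (hint (hi.max hmhi) fun a =>
        ⟨(hσ i a).1.trans (le_max_left _ _), max_le (hσ i a).2 (hhi01 a).2⟩)
        fun a => le_max_left _ _⟩

/-! ### Coordinates of the state space -/

/-- Indices of the coordinates of the state `(x, z)`: `inl i` stands for `x_i`, and `inr (i, j)`
for `z_ij`. -/
abbrev NetCoord (n : ℕ) : Type := Fin n ⊕ OffDiag n

/-- The coordinates of a state, as continuous linear functionals. -/
def coordL {n : ℕ} : NetCoord n → NetState n →L[ℝ] ℝ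
  | .inl i => (ContinuousLinearMap.proj i).comp (ContinuousLinearMap.fst ℝ _ _)
  | .inr p => (ContinuousLinearMap.proj p).comp (ContinuousLinearMap.snd ℝ _ _)

/-- The state with given coordinates. -/
def ofCoord {n : ℕ} (f : NetCoord n → ℝ) : NetState n := (fun i => f (.inl i), fun p => f (.inr p))

theorem coordL_ofCoord {n : ℕ} (f : NetCoord n → ℝ) (q : NetCoord n) :
    coordL q (ofCoord f) = f q := by
  cases q <;> rfl

theorem continuous_ofCoord {n : ℕ} : Continuous (ofCoord (n := n)) := by
  unfold ofCoord; fun_prop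

theorem abs_coordL_le {n : ℕ} (q : NetCoord n) (v : NetState n) : |coordL q v| ≤ ‖v‖ := by
  cases q with
  | inl i => exact (norm_le_pi_norm v.1 i).trans (norm_fst_le v)
  | inr p => exact (norm_le_pi_norm v.2 p).trans (norm_snd_le v)

theorem norm_le_of_abs_coordL_le {n : ℕ} {v : NetState n} {M : ℝ} (hM : 0 ≤ M)
    (h : ∀ q, |coordL q v| ≤ M) : ‖v‖ ≤ M :=
  norm_prod_le_iff.2 ⟨(pi_norm_le_iff_of_nonneg hM).2 fun i => h (.inl i),
    (pi_norm_le_iff_of_nonneg hM).2 fun p => h (.inr p)⟩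

theorem ext_coordL {n : ℕ} {v w : NetState n} (h : ∀ q, coordL q v = coordL q w) : v = w :=
  Prod.ext (funext fun i => h (.inl i)) (funext fun p => h (.inr p))

theorem sq_norm_le_sum_sq_coordL {n : ℕ} (v : NetState n) : ‖v‖ ^ 2 ≤ ∑ q, coordL q v ^ 2 := by
  have h0 : 0 ≤ ∑ q, coordL q v ^ 2 := Finset.sum_nonneg fun q _ => sq_nonneg _
  rw [← Real.sq_sqrt h0]
  gcongr
  refine norm_le_of_abs_coordL_le (Real.sqrt_nonneg _) fun q => Real.abs_le_sqrt ?_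
  exact Finset.single_le_sum (f := fun q => coordL q v ^ 2) (fun q _ => sq_nonneg _)
    (Finset.mem_univ q)

theorem sum_sq_coordL_le {n : ℕ} (v : NetState n) :
    ∑ q, coordL q v ^ 2 ≤ Fintype.card (NetCoord n) * ‖v‖ ^ 2 := by
  calc _ ≤ ∑ _q : NetCoord n, ‖v‖ ^ 2 := Finset.sum_le_sum fun q _ =>
        sq_le_sq' (neg_le_of_abs_le (abs_coordL_le q v)) (le_of_abs_le (abs_coordL_le q v))
    _ = _ := by simp

theorem HasDerivAt.coordL {n : ℕ} {u : ℝ → NetState n} {u' : NetState n} {t : ℝ}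
    (h : HasDerivAt u u' t) (q : NetCoord n) :
    HasDerivAt (fun s => _root_.coordL q (u s)) (_root_.coordL q u') t :=
  ((_root_.coordL q).hasFDerivAt).comp_hasDerivAt t h

theorem AbsolutelyContinuousOnInterval.coordL {n : ℕ} {u : ℝ → NetState n} {a b : ℝ}
    (h : AbsolutelyContinuousOnInterval u a b) (q : NetCoord n) :
    AbsolutelyContinuousOnInterval (fun s => _root_.coordL q (u s)) a b :=
  h.lipschitz_comp (_root_.coordL q).lipschitz

/-! ### Coordinatewise form of the network equations -/

/-- The present value `u(t) = u_t(0)` of a history. -/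
def present {n : ℕ} (φ : NetHistory n) : NetState n := φ ⟨0, le_refl (0 : ℝ)⟩

theorem present_historyAt {n : ℕ} (u : ℝ → NetState n) (t : ℝ) : present (historyAt u t) = u t := by
  simp [present, historyAt]

theorem continuous_historyAt {n : ℕ} {u : ℝ → NetState n} {t : ℝ} (hu : ContinuousOn u (Iic t)) :
    Continuous (historyAt u t) :=
  hu.comp_continuous (by fun_prop) fun s => by have := s.2; simp only [mem_Iic] at *; linarith

namespace NeuralNet

variable {n : ℕ}

/-- The set of signals entering the equation of a coordinate: `k ≠ i` for `x_i`, and a single one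
for `z_ij`. -/
def Input : NetCoord n → Type
  | .inl i => {k : Fin n // k ≠ i}
  | .inr _ => Unit

instance : ∀ q : NetCoord n, Fintype (Input q)
  | .inl i => inferInstanceAs (Fintype {k : Fin n // k ≠ i})
  | .inr _ => inferInstanceAs (Fintype Unit)

instance (p : OffDiag n) : Unique (Input (.inr p : NetCoord n)) :=
  inferInstanceAs (Unique Unit)

/-- The pair `(k, i)` whose signal `∫ σ(x_k(t + τ) - Γ_k) dμ_ki(τ)` is the given input. -/
def Input.pair : ∀ {q : NetCoord n}, Input q → OffDiag n
  | .inl i, k => ⟨(k.1, i), k.2⟩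
  | .inr p, _ => p

/-- The factor in front of the given input: `z_ki - c_ki`, respectively `d_ij [x_j]^+`. -/
def weight (N : NeuralNet n) : ∀ {q : NetCoord n}, Input q → NetState n → ℝ
  | .inl i, k, v => v.2 ⟨(k.1, i), k.2⟩ - N.c ⟨(k.1, i), k.2⟩
  | .inr p, _, v => N.d p * max (v.1 p.1.2) 0

/-- The decay coefficient `A_i` or `B_ij` of a coordinate. -/
def rate (N : NeuralNet n) : NetCoord n → ℝ → ℝ
  | .inl i => N.A i
  | .inr p => N.B p

/-- The stimulus of a coordinate; only the `x_i` have one. -/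
def stim (N : NeuralNet n) : NetCoord n → ℝ → ℝ
  | .inl i => N.I i
  | .inr _ => fun _ => 0

/-- The inhomogeneous part of the equation of the coordinate `q` of the sigmoidal system, with the
factors evaluated at the state `v`. -/
noncomputable def inflow (N : NeuralNet n) (ε t : ℝ) (v : NetState n) (φ : NetHistory n)
    (q : NetCoord n) : ℝ :=
  ∑ k : Input q, N.weight k v * N.sigSignal ε φ k.pair + N.stim q t

/-- The coordinate `q` of the right-hand side of the sigmoidal system, where the present state is
replaced by its image under `ρ` wherever it occurs. -/
noncomputable def field (N : NeuralNet n) (ρ : NetState n → NetState n) (ε t : ℝ) (φ : NetHistory n)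
    (q : NetCoord n) : ℝ :=
  -N.rate q (coordL q (ρ (present φ))) * coordL q (ρ (present φ)) + N.inflow ε t (ρ (present φ)) φ q

theorem coordL_rhs (N : NeuralNet n) (ε t : ℝ) (φ : NetHistory n) (q : NetCoord n) :
    coordL q (N.decay φ + N.sigTerm ε φ + N.stimuli t) = N.field id ε t φ q := by
  cases q with
  | inl i => exact add_assoc _ _ _
  | inr p =>
    refine (add_assoc _ _ _).trans (congrArg₂ _ rfl (congrArg₂ _ ?_ rfl))
    rw [Fintype.sum_unique]
    exact mul_right_comm _ _ _

theorem mem_chiTerm_iff (N : NeuralNet n) (ε : ℝ) (φ : NetHistory n) (w : NetState n) :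
    w ∈ N.chiTerm ε φ ↔
      ∀ q, coordL q w ∈ ∑ k : Input q, N.weight k (present φ) • N.chiSignal ε φ k.pair := by
  have hr : ∀ p : OffDiag n, ∑ k : Input (.inr p), N.weight k (present φ) • N.chiSignal ε φ k.pair
      = (N.d p * max ((present φ).1 p.1.2) 0) • N.chiSignal ε φ p := fun p =>
    Fintype.sum_unique _
  constructor
  · rintro ⟨h1, h2⟩ (i | p)
    · exact h1 i
    · rw [hr]; exact h2 p
  · refine fun h => ⟨fun i => h (.inl i), fun p => ?_⟩
    have := h (.inr p)
    rwa [hr] at this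

theorem coordL_sub_decay_sub_stimuli (N : NeuralNet n) (t : ℝ) (φ : NetHistory n) (w : NetState n)
    (q : NetCoord n) : coordL q (w - N.decay φ - N.stimuli t) =
      coordL q w + N.rate q (coordL q (present φ)) * coordL q (present φ) - N.stim q t := by
  cases q with
  | inl i =>
    change w.1 i - -N.A i _ * _ - _ = w.1 i + _ - _
    rw [neg_mul, sub_neg_eq_add]; rfl
  | inr p =>
    change w.2 p - -N.B p _ * _ - _ = w.2 p + _ - _
    rw [neg_mul, sub_neg_eq_add]; rfl

/-! ### Bounds on the right-hand side -/

theorem HypM.isFiniteMeasure {N : NeuralNet n} {γ : ℝ} (hγ : 0 < γ) (hM : N.HypM γ)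
    (p : OffDiag n) : IsFiniteMeasure (N.μ p) := by
  refine ⟨lt_of_le_of_lt ?_ (hM p)⟩
  rw [← lintegral_one]
  refine lintegral_mono fun τ => ?_
  rw [ENNReal.one_le_ofReal, Real.one_le_exp_iff]
  exact mul_nonneg_of_nonpos_of_nonpos (by linarith) τ.2

theorem HypD.locallyLipschitz_rate {N : NeuralNet n} (hD : N.HypD) (q : NetCoord n) :
    LocallyLipschitz (N.rate q) := by
  cases q with
  | inl i => exact hD.1 i
  | inr p => exact hD.2.1 p

theorem HypD.rate_nonneg {N : NeuralNet n} (hD : N.HypD) (q : NetCoord n) (y : ℝ) :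
    0 ≤ N.rate q y := by
  obtain ⟨α, hα, hA, hB⟩ := hD.2.2
  cases q with
  | inl i => exact hα.le.trans (hA i y)
  | inr p => exact hα.le.trans (hB p y)

theorem HypI.continuous_stim {N : NeuralNet n} (hI : N.HypI) (q : NetCoord n) :
    Continuous (N.stim q) := by
  cases q with
  | inl i => exact hI i
  | inr p => exact continuous_const

theorem abs_sigSignal_le (N : NeuralNet n) (ε : ℝ) (φ : NetHistory n) (p : OffDiag n)
    [IsFiniteMeasure (N.μ p)] : |N.sigSignal ε φ p| ≤ (N.μ p).real univ := by
  simpa [sigSignal] using norm_integral_le_of_norm_le_const (μ := N.μ p) (C := 1)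
    (f := fun τ => sigmoidFun ε ((φ τ).1 p.1.1 - N.Γ p.1.1))
    (ae_of_all _ fun τ => norm_sigmoidFun_le_one _ _)

/-- The factors are Lipschitz functions of the state, with a common constant. -/
theorem exists_weight_lipschitz (N : NeuralNet n) : ∃ C : ℝ, 0 ≤ C ∧
    (∀ (q : NetCoord n) (k : Input q) (v w : NetState n),
      |N.weight k v - N.weight k w| ≤ C * ‖v - w‖) ∧
    ∀ (q : NetCoord n) (k : Input q) (v : NetState n), |N.weight k v| ≤ C * (1 + ‖v‖) := by
  have hc : 0 ≤ ∑ p, N.c p := Finset.sum_nonneg fun p _ => N.c_nonneg p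
  have hd : 0 ≤ ∑ p, N.d p := Finset.sum_nonneg fun p _ => N.d_nonneg p
  have hcp : ∀ p, N.c p ≤ ∑ p, N.c p := fun p =>
    Finset.single_le_sum (fun p _ => N.c_nonneg p) (Finset.mem_univ p)
  have hdp : ∀ p, N.d p ≤ ∑ p, N.d p := fun p =>
    Finset.single_le_sum (fun p _ => N.d_nonneg p) (Finset.mem_univ p)
  set C := 1 + ∑ p, N.c p + ∑ p, N.d p with hC
  have hlip : ∀ (q : NetCoord n) (k : Input q) (v w : NetState n),
      |N.weight k v - N.weight k w| ≤ C * ‖v - w‖ := by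
    rintro (i | p) k v w
    · change |(v.2 _ - N.c _) - (w.2 _ - N.c _)| ≤ _
      rw [sub_sub_sub_cancel_right]
      refine (abs_coordL_le (.inr ⟨(k.1, i), k.2⟩) (v - w)).trans ?_
      exact le_mul_of_one_le_left (norm_nonneg _) (by linarith)
    · change |N.d p * max (v.1 p.1.2) 0 - N.d p * max (w.1 p.1.2) 0| ≤ _
      rw [← mul_sub, abs_mul, abs_of_nonneg (N.d_nonneg p)]
      have h1 : |max (v.1 p.1.2) 0 - max (w.1 p.1.2) 0| ≤ ‖v - w‖ :=
        (abs_max_sub_max_le_abs _ _ _).trans (abs_coordL_le (.inl p.1.2) (v - w))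
      exact mul_le_mul (by linarith [hdp p]) h1 (abs_nonneg _) (by linarith)
  refine ⟨C, by linarith, hlip, fun q k v => ?_⟩
  have h0 : |N.weight k 0| ≤ C := by
    rcases q with i | p
    · change |(0 : ℝ) - N.c _| ≤ C
      rw [zero_sub, abs_neg, abs_of_nonneg (N.c_nonneg _)]
      linarith [hcp ⟨(k.1, i), k.2⟩]
    · change |N.d p * max 0 0| ≤ C
      simp only [max_self, mul_zero, abs_zero]; linarith
  have h1 := hlip q k v 0
  rw [sub_zero] at h1
  calc |N.weight k v| = |(N.weight k v - N.weight k 0) + N.weight k 0| := by rw [sub_add_cancel]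
    _ ≤ _ := abs_add_le _ _
    _ ≤ C * (1 + ‖v‖) := by linarith

theorem continuous_weight (N : NeuralNet n) {q : NetCoord n} (k : Input q) :
    Continuous (N.weight k) := by
  obtain ⟨C, hC, h, -⟩ := N.exists_weight_lipschitz
  exact (LipschitzWith.of_dist_le_mul (K := ⟨C, hC⟩) fun v w => by
    rw [dist_eq_norm, dist_eq_norm]; exact h q k v w).continuous

/-- The inhomogeneous part grows at most linearly in the state. -/
theorem HypI.exists_abs_inflow_le {N : NeuralNet n} [∀ p, IsFiniteMeasure (N.μ p)] (hI : N.HypI)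
    (t₀ t₁ : ℝ) :
    ∃ K : ℝ, 0 ≤ K ∧ ∀ ε, ∀ t ∈ Icc t₀ t₁, ∀ v φ q, |N.inflow ε t v φ q| ≤ K * (1 + ‖v‖) := by
  obtain ⟨C, hC, -, hw⟩ := N.exists_weight_lipschitz
  have hst : ∀ q, ∃ S, ∀ t ∈ Icc t₀ t₁, ‖N.stim q t‖ ≤ S := fun q =>
    isCompact_Icc.exists_bound_of_continuousOn (hI.continuous_stim q).continuousOn
  choose S hS using hst
  have hK0 : ∀ q : NetCoord n, 0 ≤ ∑ k : Input q, C * (N.μ k.pair).real univ + |S q| := fun q =>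
    add_nonneg (Finset.sum_nonneg fun k _ => by positivity) (abs_nonneg _)
  refine ⟨∑ q : NetCoord n, (∑ k : Input q, C * (N.μ k.pair).real univ + |S q|),
    Finset.sum_nonneg fun q _ => hK0 q, fun ε t ht v φ q => ?_⟩
  have h1 : (1 : ℝ) ≤ 1 + ‖v‖ := by linarith [norm_nonneg v]
  calc |N.inflow ε t v φ q|
      ≤ ∑ k : Input q, |N.weight k v * N.sigSignal ε φ k.pair| + |N.stim q t| :=
        (abs_add_le _ _).trans (add_le_add_left (Finset.abs_sum_le_sum_abs _ _) _)
    _ ≤ ∑ k : Input q, C * (N.μ k.pair).real univ * (1 + ‖v‖) + |S q| * (1 + ‖v‖) := by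
        refine add_le_add (Finset.sum_le_sum fun k _ => ?_) ?_
        · rw [abs_mul]
          calc _ ≤ (C * (1 + ‖v‖)) * (N.μ k.pair).real univ :=
                mul_le_mul (hw q k v) (N.abs_sigSignal_le ε φ _) (abs_nonneg _) (by positivity)
            _ = _ := by ring
        · exact ((hS q t ht).trans (le_abs_self _)).trans
            (le_mul_of_one_le_right (abs_nonneg _) h1)
    _ = (∑ k : Input q, C * (N.μ k.pair).real univ + |S q|) * (1 + ‖v‖) := by
        rw [add_mul, Finset.sum_mul]
    _ ≤ _ := by
        gcongr
        exact Finset.single_le_sum (f := fun q : NetCoord n =>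
          ∑ k : Input q, C * (N.μ k.pair).real univ + |S q|) (fun q _ => hK0 q) (Finset.mem_univ q)

/-- Maps of the state space that shrink every coordinate without changing its sign. -/
structure IsShrinking (ρ : NetState n → NetState n) : Prop where
  abs_le : ∀ v q, |coordL q (ρ v)| ≤ |coordL q v|
  mul_nonneg : ∀ v q, 0 ≤ coordL q (ρ v) * coordL q v

theorem isShrinking_id : IsShrinking (id : NetState n → NetState n) :=
  ⟨fun _ _ => le_rfl, fun _ _ => mul_self_nonneg _⟩

/-- `u` satisfies `u_q' = field` in all coordinates, almost everywhere on `[t₀, t₁]`. -/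
def IsFieldSolution (N : NeuralNet n) (ρ : NetState n → NetState n) (ε t₀ t₁ : ℝ)
    (u : ℝ → NetState n) : Prop :=
  AbsolutelyContinuousOnInterval u t₀ t₁ ∧ ∀ᵐ t ∂volume.restrict (Icc t₀ t₁), ∀ q,
    HasDerivAt (fun s => coordL q (u s)) (N.field ρ ε t (historyAt u t) q) t

/-- A priori bound: since the decay terms have the right sign and the other terms grow linearly,
`V = 1 + ∑ u_q²` satisfies `V' ≤ const * V`. The bound does not depend on `ε` and `ρ`. -/
theorem exists_apriori_bound {N : NeuralNet n} [∀ p, IsFiniteMeasure (N.μ p)] (hD : N.HypD)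
    (hI : N.HypI) (t₀ t₁ r : ℝ) :
    ∃ R : ℝ, 0 ≤ R ∧ ∀ ρ, IsShrinking ρ → ∀ ε u, N.IsFieldSolution ρ ε t₀ t₁ u → ‖u t₀‖ ≤ r →
      ∀ t ∈ Icc t₀ t₁, ‖u t‖ ≤ R := by
  obtain ⟨K, hK, hin⟩ := hI.exists_abs_inflow_le t₀ t₁
  set c : ℝ := (Fintype.card (NetCoord n) : ℝ) with hc
  have hc0 : 0 ≤ c := Nat.cast_nonneg _
  refine ⟨Real.sqrt ((1 + c * r ^ 2) * Real.exp (c * (4 * K) * (t₁ - t₀))), Real.sqrt_nonneg _,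
    fun ρ hρ ε u hu hr t ht => ?_⟩
  have hnorm : ∀ v, ‖ρ v‖ ≤ ‖v‖ := fun v => norm_le_of_abs_coordL_le (norm_nonneg _) fun q =>
    (hρ.abs_le v q).trans (abs_coordL_le q v)
  set V : ℝ → ℝ := fun s => 1 + ∑ q, coordL q (u s) ^ 2 with hV
  have hVac : AbsolutelyContinuousOnInterval V t₀ t₁ := by
    have h1 : AbsolutelyContinuousOnInterval (fun _ : ℝ => (1 : ℝ)) t₀ t₁ :=
      LipschitzOnWith.absolutelyContinuousOnInterval (LipschitzWith.const (1 : ℝ)).lipschitzOnWith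
    refine h1.fun_add (.finset_sum _ fun q _ => ?_)
    simp only [pow_two]
    exact (hu.1.coordL q).fun_mul (hu.1.coordL q)
  have hsub : Icc t₀ t ⊆ Icc t₀ t₁ := Icc_subset_Icc_right ht.2
  have hG : V t ≤ V t₀ * Real.exp (c * (4 * K) * (t - t₀)) := by
    refine (hVac.mono ?_).le_exp_of_ae_deriv_le_mul ht.1 ?_
    · rwa [uIcc_of_le ht.1, uIcc_of_le (ht.1.trans ht.2)]
    filter_upwards [ae_restrict_of_ae_restrict_of_subset hsub hu.2,
      ae_restrict_mem measurableSet_Icc] with s hs hsm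
    refine ⟨_, (HasDerivAt.fun_sum fun q _ => (hs q).pow 2).const_add 1, ?_⟩
    have hsq := sq_norm_le_sum_sq_coordL (u s)
    have hterm : ∀ q, N.field ρ ε s (historyAt u s) q * coordL q (u s) ≤ 2 * K * V s := by
      intro q
      have h1 := hρ.mul_nonneg (u s) q
      have h2 := hD.rate_nonneg q (coordL q (ρ (u s)))
      have h3 := (hin ε s (hsub hsm) (ρ (u s)) (historyAt u s) q)
      have h4 : N.inflow ε s (ρ (u s)) (historyAt u s) q * coordL q (u s)
          ≤ (K * (1 + ‖u s‖)) * ‖u s‖ := by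
        refine (le_abs_self _).trans ?_
        rw [abs_mul]
        refine mul_le_mul (h3.trans ?_) (abs_coordL_le q _) (abs_nonneg _) (by positivity)
        gcongr
        exact hnorm _
      have h5 : (K * (1 + ‖u s‖)) * ‖u s‖ ≤ 2 * K * V s := by
        have : (1 + ‖u s‖) * ‖u s‖ ≤ 2 * V s := by
          simp only [hV]; nlinarith [sq_nonneg (‖u s‖ - 1), norm_nonneg (u s)]
        nlinarith
      rw [field, present_historyAt]
      nlinarith [mul_nonneg h2 h1]
    calc _ = ∑ q, 2 * (N.field ρ ε s (historyAt u s) q * coordL q (u s)) :=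
          Finset.sum_congr rfl fun q _ => by simp; ring
      _ ≤ ∑ _q : NetCoord n, 2 * (2 * K * V s) :=
          Finset.sum_le_sum fun q _ => by linarith [hterm q]
      _ = c * (4 * K) * V s := by
          rw [Finset.sum_const, nsmul_eq_mul, Finset.card_univ, ← hc]; ring
  refine Real.le_sqrt_of_sq_le ?_
  have hV0 : V t₀ ≤ 1 + c * r ^ 2 := by
    have := sum_sq_coordL_le (u t₀)
    have h2 : ‖u t₀‖ ^ 2 ≤ r ^ 2 := by gcongr
    have h3 : c * ‖u t₀‖ ^ 2 ≤ c * r ^ 2 := by gcongr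
    simp only [hV]; linarith
  calc ‖u t‖ ^ 2 ≤ V t := by simp only [hV]; linarith [sq_norm_le_sum_sq_coordL (u t)]
    _ ≤ _ := hG
    _ ≤ _ := by
      have : t ≤ t₁ := ht.2
      gcongr

/-- Bounded solutions are Lipschitz, uniformly in `ε`. -/
theorem exists_lipschitz_bound {N : NeuralNet n} [∀ p, IsFiniteMeasure (N.μ p)] (hD : N.HypD)
    (hI : N.HypI) (t₀ t₁ R : ℝ) :
    ∃ M : NNReal, ∀ ε u, N.IsFieldSolution id ε t₀ t₁ u → (∀ t ∈ Icc t₀ t₁, ‖u t‖ ≤ R) →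
      LipschitzOnWith M u (Icc t₀ t₁) := by
  obtain ⟨K, hK, hin⟩ := hI.exists_abs_inflow_le t₀ t₁
  have hdec : ∀ q, ∃ S, ∀ y ∈ Icc (-R) R, ‖N.rate q y * y‖ ≤ S := fun q =>
    isCompact_Icc.exists_bound_of_continuousOn
      ((hD.locallyLipschitz_rate q).continuous.mul continuous_id).continuousOn
  choose S hS using hdec
  set M : ℝ := ∑ q, |S q| + K * (1 + |R|) with hMdef
  have hM0 : 0 ≤ M := by positivity
  refine ⟨M.toNNReal, fun ε u hu hR => LipschitzOnWith.of_dist_le_mul ?_⟩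
  have hmain : ∀ s ∈ Icc t₀ t₁, ∀ t ∈ Icc t₀ t₁, s ≤ t → ‖u t - u s‖ ≤ M * (t - s) := by
    intro s hs t ht hst
    have hsub : Icc s t ⊆ Icc t₀ t₁ := Icc_subset_Icc hs.1 ht.2
    have hbd : ∀ᵐ x ∂volume.restrict (Icc s t), ∀ q, ∃ f',
        HasDerivAt (fun s => coordL q (u s)) f' x ∧ |f'| ≤ M := by
      filter_upwards [ae_restrict_of_ae_restrict_of_subset hsub hu.2,
        ae_restrict_mem measurableSet_Icc] with x hx hxm q
      refine ⟨_, hx q, ?_⟩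
      rw [field, present_historyAt, id]
      have h1 := hR x (hsub hxm)
      refine (abs_add_le _ _).trans (add_le_add ?_ ((hin ε x (hsub hxm) _ _ q).trans ?_))
      · rw [neg_mul, abs_neg]
        refine (hS q _ (abs_le.1 ((abs_coordL_le q _).trans h1))).trans ?_
        exact (le_abs_self _).trans
          (Finset.single_le_sum (f := fun q => |S q|) (fun q _ => abs_nonneg _) (Finset.mem_univ q))
      · gcongr
        exact h1.trans (le_abs_self R)
    refine norm_le_of_abs_coordL_le (mul_nonneg hM0 (by linarith)) fun q => ?_
    have hac : AbsolutelyContinuousOnInterval (fun s => coordL q (u s)) s t :=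
      (hu.1.coordL q).mono (by rwa [uIcc_of_le hst, uIcc_of_le (hs.1.trans hs.2)])
    rw [map_sub, abs_le']
    refine ⟨hac.sub_le_of_ae_deriv_le hst ?_, ?_⟩
    · filter_upwards [hbd] with x hx
      obtain ⟨f', h1, h2⟩ := hx q
      exact ⟨f', h1, (abs_le.1 h2).2⟩
    · have := hac.fun_neg.sub_le_of_ae_deriv_le (M := M) hst (by
        filter_upwards [hbd] with x hx
        obtain ⟨f', h1, h2⟩ := hx q
        exact ⟨-f', h1.neg, by linarith [(abs_le.1 h2).1]⟩)
      linarith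
  intro x hx y hy
  rw [Real.coe_toNNReal _ hM0]
  rcases le_total x y with h | h
  · rw [dist_comm, dist_eq_norm, dist_comm x y, Real.dist_eq, abs_of_nonneg (by linarith)]
    exact hmain x hx y hy h
  · rw [dist_eq_norm, Real.dist_eq, abs_of_nonneg (by linarith)]
    exact hmain y hy x hx h

end NeuralNet

/-! ### Compactness and convergence along moving points -/

theorem tendsto_prod_nhds_of_tendstoUniformlyOn {E : Type*} [PseudoMetricSpace E]
    {v : ℕ → ℝ → E} {w : ℝ → E} {s : Set ℝ} {r : ℝ} (hs : s ∈ 𝓝 r)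
    (h : TendstoUniformlyOn v w atTop s) (hw : ContinuousAt w r) :
    Tendsto (fun q : ℕ × ℝ => v q.1 q.2) (atTop ×ˢ 𝓝 r) (𝓝 (w r)) := by
  rw [Metric.tendsto_nhds]
  intro δ hδ
  have h1 := (Metric.tendstoUniformlyOn_iff.1 h (δ / 2) (half_pos hδ)).prod_mk
    ((Metric.tendsto_nhds.1 hw (δ / 2) (half_pos hδ)).and hs)
  filter_upwards [h1] with q hq
  have h2 := hq.1 q.2 hq.2.2
  rw [dist_comm] at h2
  linarith [dist_triangle (v q.1 q.2) (w q.2) (w r), hq.2.1]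

/-- The Arzelà-Ascoli theorem for sequences of uniformly bounded and uniformly Lipschitz
functions. -/
theorem exists_subseq_tendstoUniformlyOn_of_lipschitz {E : Type*} [NormedAddCommGroup E]
    [ProperSpace E] {v : ℕ → ℝ → E} {a b R : ℝ} {M : NNReal} (hab : a ≤ b)
    (hM : ∀ m, LipschitzOnWith M (v m) (Icc a b)) (hR : ∀ m, ∀ t ∈ Icc a b, ‖v m t‖ ≤ R) :
    ∃ ψ : ℕ → ℕ, StrictMono ψ ∧ ∃ w : ℝ → E, LipschitzOnWith M w (Icc a b) ∧
      TendstoUniformlyOn (fun k => v (ψ k)) w atTop (Icc a b) := by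
  let f : ℕ → BoundedContinuousFunction (Icc a b) E := fun m =>
    BoundedContinuousFunction.mkOfCompact
      ⟨(Icc a b).domRestrict (v m), (hM m).continuousOn.domRestrict⟩
  have hlip : ∀ g : range f, LipschitzWith M
      ((g : BoundedContinuousFunction (Icc a b) E) : _ → E) := by
    rintro ⟨_, m, rfl⟩
    exact lipschitzOnWith_iff_restrict.1 (hM m)
  have hcomp := BoundedContinuousFunction.arzela_ascoli (Metric.closedBall (0 : E) R)
    (isCompact_closedBall 0 R) (range f) (by
      rintro _ x ⟨m, rfl⟩
      exact mem_closedBall_zero_iff.2 (hR m x x.2))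
    (LipschitzWith.uniformEquicontinuous _ M hlip).equicontinuous
  obtain ⟨g, -, ψ, hψ, hg⟩ := hcomp.tendsto_subseq fun m => subset_closure (mem_range_self m)
  have hunif : TendstoUniformlyOn (fun k => v (ψ k)) (IccExtend hab g) atTop (Icc a b) := by
    rw [tendstoUniformlyOn_iff_tendstoUniformly_comp_coe]
    have := BoundedContinuousFunction.tendsto_iff_tendstoUniformly.1 hg
    convert! this using 1
    ext x
    simp
  refine ⟨ψ, hψ, _, LipschitzOnWith.of_dist_le_mul fun x hx y hy => ?_, hunif⟩
  exact le_of_tendsto ((hunif.tendsto_at hx).dist (hunif.tendsto_at hy))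
    (Eventually.of_forall fun k => (hM (ψ k)).dist_le_mul x hx y hy)

theorem mul_le_max_mul {a l h s : ℝ} (h1 : l ≤ s) (h2 : s ≤ h) : a * s ≤ max (a * l) (a * h) := by
  rcases le_total 0 a with ha | ha
  · exact le_max_of_le_right (mul_le_mul_of_nonneg_left h2 ha)
  · exact le_max_of_le_left (mul_le_mul_of_nonpos_left h1 ha)

theorem min_mul_le_mul {a l h s : ℝ} (h1 : l ≤ s) (h2 : s ≤ h) : min (a * l) (a * h) ≤ a * s := by
  rcases le_total 0 a with ha | ha
  · exact min_le_of_left_le (mul_le_mul_of_nonneg_left h1 ha)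
  · exact min_le_of_right_le (mul_le_mul_of_nonpos_left h2 ha)

/-! ### Histories -/

theorem continuousOn_Iic_of_historyAt {n : ℕ} {u : ℝ → NetState n} {φ : NetHistory n} {t₀ t₁ : ℝ}
    (h01 : t₀ ≤ t₁) (h : historyAt u t₀ = φ) (hφ : Continuous φ) (hu : ContinuousOn u (Icc t₀ t₁)) :
    ContinuousOn u (Iic t₁) := by
  rw [← Iic_union_Icc_eq_Iic h01]
  refine ContinuousOn.union_of_isClosed ?_ hu isClosed_Iic isClosed_Icc
  have hmin : Continuous fun t => φ ⟨min (t - t₀) 0, mem_Iic.2 (min_le_right _ _)⟩ :=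
    hφ.comp (Continuous.subtype_mk (by fun_prop) _)
  refine hmin.continuousOn.congr fun t ht => ?_
  have ht' : t - t₀ ≤ 0 := sub_nonpos.2 ht
  simp [← h, historyAt, min_eq_left ht']

theorem norm_le_exp_mul_gammaNorm {n : ℕ} {γ : ℝ} {φ : NetHistory n} (h : φ ∈ CGamma n γ)
    (s : Iic (0 : ℝ)) : ‖φ s‖ ≤ Real.exp (-(γ * (s : ℝ))) * gammaNorm γ φ := by
  have h1 : Real.exp (γ * (s : ℝ)) * ‖φ s‖ ≤ gammaNorm γ φ := le_ciSup (CGamma.bddAbove h) s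
  calc ‖φ s‖ = Real.exp (-(γ * (s : ℝ))) * (Real.exp (γ * (s : ℝ)) * ‖φ s‖) := by
        rw [← mul_assoc, ← Real.exp_add]; simp
    _ ≤ _ := by gcongr

namespace NeuralNet

variable {n : ℕ} {N : NeuralNet n}

/-! ### Sigmoidal solutions solve the inflated inclusion -/

theorem continuous_signal_arg {φ : NetHistory n} (hφ : Continuous φ) (N : NeuralNet n) (i : Fin n) :
    Continuous fun τ => (φ τ).1 i - N.Γ i :=
  ((continuous_apply i).comp (continuous_fst.comp hφ)).sub continuous_const

theorem sigSignal_mem_chiSignal {ε : ℝ} (hε : 0 < ε) (hε1 : ε < 1) {φ : NetHistory n}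
    (hφ : Continuous φ) (p : OffDiag n) [IsFiniteMeasure (N.μ p)] :
    N.sigSignal ε φ p ∈ N.chiSignal ε φ p :=
  ⟨_, fun _ => sigmoidFun_mem_chiSet hε hε1 _, Integrable.of_bound
    ((continuous_sigmoidFun ε).comp (continuous_signal_arg hφ N _)).aestronglyMeasurable 1
    (ae_of_all _ fun _ => norm_sigmoidFun_le_one _ _), rfl⟩

theorem sigTerm_mem_chiTerm [∀ p, IsFiniteMeasure (N.μ p)] {ε : ℝ} (hε : 0 < ε) (hε1 : ε < 1)
    {φ : NetHistory n} (hφ : Continuous φ) : N.sigTerm ε φ ∈ N.chiTerm ε φ :=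
  ⟨fun _ => (Set.mem_fintype_sum _ _).2
    ⟨_, fun _ => Set.smul_mem_smul_set (sigSignal_mem_chiSignal hε hε1 hφ _), rfl⟩,
  fun p => ⟨_, sigSignal_mem_chiSignal hε hε1 hφ p, mul_right_comm _ _ _⟩⟩

theorem IsSigmoidalSolution.continuousOn {ε t₀ T : ℝ} (hT : 0 < T) {φ : NetHistory n}
    (hφ : Continuous φ) {u : ℝ → NetState n} (hu : N.IsSigmoidalSolution ε t₀ T φ u) :
    ContinuousOn u (Iic (t₀ + T)) := by
  have h01 : t₀ ≤ t₀ + T := by linarith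
  refine continuousOn_Iic_of_historyAt h01 hu.1 hφ ?_
  simpa [uIcc_of_le h01] using hu.2.1.continuousOn

theorem IsSigmoidalSolution.isInflatedSolution [∀ p, IsFiniteMeasure (N.μ p)] {ε t₀ T : ℝ}
    (hε : 0 < ε) (hε1 : ε < 1) (hT : 0 < T) {φ : NetHistory n} (hφ : Continuous φ)
    {u : ℝ → NetState n} (hu : N.IsSigmoidalSolution ε t₀ T φ u) :
    N.IsInflatedSolution ε t₀ T φ u := by
  refine ⟨hu.1, hu.2.1, ?_⟩
  filter_upwards [hu.2.2, ae_restrict_mem measurableSet_Icc] with t ht htm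
  exact ⟨_, sigTerm_mem_chiTerm hε hε1
    (continuous_historyAt ((hu.continuousOn hT hφ).mono (Iic_subset_Iic.2 htm.2))), ht⟩

theorem IsSigmoidalSolution.isFieldSolution {ε t₀ T : ℝ} {φ : NetHistory n} {u : ℝ → NetState n}
    (hu : N.IsSigmoidalSolution ε t₀ T φ u) : N.IsFieldSolution id ε t₀ (t₀ + T) u := by
  refine ⟨hu.2.1, ?_⟩
  filter_upwards [hu.2.2] with t ht q
  rw [← coordL_rhs]
  exact ht.coordL q

/-! ### Limits of sigmoidal solutions -/

/-- If the sigmoidal solutions `v m` converge locally uniformly to `w`, and `w` is differentiable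
at `t`, then `w` satisfies the Heaviside inclusion at `t`, in every coordinate: near `t` and for
large `m`, the derivatives of `v m` are, up to small errors, between the end points of the interval
in which `w'` is to lie. -/
theorem coordL_deriv_mem_of_tendsto [∀ p, IsFiniteMeasure (N.μ p)] (hD : N.HypD) (hI : N.HypI)
    {ε : ℕ → ℝ} (hε : Tendsto ε atTop (𝓝[>] 0)) {t₀ t₁ t : ℝ} (ht : t ∈ Ioo t₀ t₁)
    {v : ℕ → ℝ → NetState n} {w : ℝ → NetState n}
    (hv : ∀ m, N.IsFieldSolution id (ε m) t₀ t₁ (v m)) (hvc : ∀ m, ContinuousOn (v m) (Iic t₁))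
    (hwc : ContinuousOn w (Iic t₁)) (hlim : ∀ c, TendstoUniformlyOn v w atTop (Icc c t₁))
    {w' : NetState n} (hw : HasDerivAt w w' t) (q : NetCoord n) :
    coordL q w' + N.rate q (coordL q (w t)) * coordL q (w t) - N.stim q t ∈
      ∑ k : Input q, N.weight k (w t) • N.chiSignal 0 (historyAt w t) k.pair := by
  have hpath : ∀ r < t₁, Tendsto (fun x : ℕ × ℝ => v x.1 x.2) (atTop ×ˢ 𝓝 r) (𝓝 (w r)) :=
    fun r hr => tendsto_prod_nhds_of_tendstoUniformlyOn
      (Icc_mem_nhds (sub_one_lt r) hr) (hlim (r - 1)) (hwc.continuousAt (Iic_mem_nhds hr))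
  have hwh : Continuous (historyAt w t) :=
    continuous_historyAt (hwc.mono (Iic_subset_Iic.2 ht.2.le))
  have hsig : ∀ p, _ := fun p => exists_bounds_integral_sigmoidFun (μ := N.μ p)
    (l := atTop ×ˢ 𝓝 t) (ε := fun x : ℕ × ℝ => ε x.1)
    (x := fun x τ => (historyAt (v x.1) x.2 τ).1 p.1.1 - N.Γ p.1.1)
    (x₀ := fun τ => (historyAt w t τ).1 p.1.1 - N.Γ p.1.1) (hε.comp tendsto_fst)
    (by
      filter_upwards [tendsto_snd.eventually (Iio_mem_nhds ht.2)] with x hx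
      exact (continuous_signal_arg (continuous_historyAt
        ((hvc x.1).mono (Iic_subset_Iic.2 (mem_Iio.1 hx).le))) N _).measurable)
    (continuous_signal_arg hwh N _).measurable
    (fun τ => by
      have hτ : t + (τ : ℝ) < t₁ := by have h1 := ht.2; have h2 := mem_Iic.1 τ.2; linarith
      have h1 : Tendsto (fun x : ℕ × ℝ => (x.1, x.2 + (τ : ℝ))) (atTop ×ˢ 𝓝 t)
          (atTop ×ˢ 𝓝 (t + (τ : ℝ))) :=
        tendsto_fst.prodMk (tendsto_snd.add_const _)
      have h2 := ((hpath _ hτ).comp h1)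
      exact (((coordL (.inl p.1.1)).continuous.tendsto _).comp h2).sub_const _)
  choose lo hi hlo hhi hb using hsig
  have hst := hpath t ht.2
  have hq : Tendsto (fun x : ℕ × ℝ => coordL q (v x.1 x.2)) (atTop ×ˢ 𝓝 t)
      (𝓝 (coordL q (w t))) := ((coordL q).continuous.tendsto _).comp hst
  have hdec : Tendsto (fun x : ℕ × ℝ => -N.rate q (coordL q (v x.1 x.2)) * coordL q (v x.1 x.2))
      (atTop ×ˢ 𝓝 t) (𝓝 (-N.rate q (coordL q (w t)) * coordL q (w t))) :=
    ((((hD.locallyLipschitz_rate q).continuous.tendsto _).comp hq).neg).mul hq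
  have hstim : Tendsto (fun x : ℕ × ℝ => N.stim q x.2) (atTop ×ˢ 𝓝 t) (𝓝 (N.stim q t)) :=
    ((hI.continuous_stim q).tendsto t).comp tendsto_snd
  have hwt : ∀ k : Input q, Tendsto (fun x : ℕ × ℝ => N.weight k (v x.1 x.2)) (atTop ×ˢ 𝓝 t)
      (𝓝 (N.weight k (w t))) := fun k => ((N.continuous_weight k).tendsto _).comp hst
  have hupper := hdec.add ((tendsto_finsetSum Finset.univ fun k _ =>
    ((hwt k).mul (hlo k.pair)).max ((hwt k).mul (hhi k.pair))).add hstim)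
  have hlower := hdec.add ((tendsto_finsetSum Finset.univ fun k _ =>
    ((hwt k).mul (hlo k.pair)).min ((hwt k).mul (hhi k.pair))).add hstim)
  have hball : ∀ᶠ x in atTop ×ˢ 𝓝 t, ∀ p, _ := eventually_all.2 hb
  have hptw : ∀ s ∈ Icc t₀ t₁, Tendsto (fun m => coordL q (v m s)) atTop (𝓝 (coordL q (w s))) :=
    fun s hs => ((coordL q).continuous.tendsto _).comp ((hlim t₀).tendsto_at hs)
  have h1 := le_of_hasDerivAt_of_tendsto_of_ae_deriv ht (fun m => (hv m).1.coordL q)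
    (fun m => (hv m).2.mono fun s hs => hs q) hptw (hw.coordL q) (fun η hη => by
      filter_upwards [hupper.eventually (gt_mem_nhds (lt_add_of_pos_right _ hη)), hball]
        with x hx1 hx2
      refine le_trans ?_ hx1.le
      rw [field, present_historyAt]
      exact add_le_add le_rfl (add_le_add (Finset.sum_le_sum fun k _ =>
        mul_le_max_mul (hx2 k.pair).1 (hx2 k.pair).2) le_rfl))
  -- the lower bound is the upper bound for the negatives
  have h2 := le_of_hasDerivAt_of_tendsto_of_ae_deriv ht (fun m => ((hv m).1.coordL q).fun_neg)
    (fun m => (hv m).2.mono fun s hs => (hs q).fun_neg) (fun s hs => (hptw s hs).neg)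
    (hw.coordL q).fun_neg (fun η hη => by
      filter_upwards [hlower.neg.eventually (gt_mem_nhds (lt_add_of_pos_right _ hη)), hball]
        with x hx1 hx2
      refine le_trans (neg_le_neg ?_) hx1.le
      rw [field, present_historyAt]
      exact add_le_add le_rfl (add_le_add (Finset.sum_le_sum fun k _ =>
        min_mul_le_mul (hx2 k.pair).1 (hx2 k.pair).2) le_rfl))
  rw [neg_le_neg_iff] at h2
  refine mem_sum_smul_of_mem_Icc (fun k => ?_) (fun k =>
    Icc_subset_aumannIntegral_chiSet_zero (continuous_signal_arg hwh N _).measurable) ?_ ?_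
  · exact le_of_tendsto_of_tendsto (hlo k.pair) (hhi k.pair)
      ((hb k.pair).mono fun x hx => hx.1.trans hx.2)
  · linarith
  · linarith

/-- Sigmoidal solutions with convergent initial data converge, along a subsequence, to a solution of
the Heaviside inclusion as `ε → 0`. -/
theorem exists_subseq_tendsto_heaviside {γ : ℝ} (hγ : 0 < γ) (hD : N.HypD) (hM : N.HypM γ)
    (hI : N.HypI) {t₀ T : ℝ} (hT : 0 < T) {r : ℝ} {ε : ℕ → ℝ} (hε0 : ∀ m, 0 < ε m)
    (hε : Tendsto ε atTop (𝓝 0)) {φ : ℕ → NetHistory n} {φ₀ : NetHistory n}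
    (hφ : ∀ m, φ m ∈ CGamma n γ ∧ gammaNorm γ (φ m) ≤ r) (hφ₀ : φ₀ ∈ CGamma n γ)
    (hlim : Tendsto (fun m => gammaNorm γ (φ m - φ₀)) atTop (𝓝 0)) {u : ℕ → ℝ → NetState n}
    (hu : ∀ m, N.IsSigmoidalSolution (ε m) t₀ T (φ m) (u m)) :
    ∃ ψ : ℕ → ℕ, StrictMono ψ ∧ ∃ w : ℝ → NetState n, ContinuousOn w (Icc t₀ (t₀ + T)) ∧
      TendstoUniformlyOn (fun k => u (ψ k)) w atTop (Icc t₀ (t₀ + T)) ∧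
      N.IsInflatedSolution 0 t₀ T φ₀ w := by
  have := fun p => hM.isFiniteMeasure hγ p
  have h01 : t₀ ≤ t₀ + T := by linarith
  obtain ⟨R, -, hR⟩ := exists_apriori_bound hD hI t₀ (t₀ + T) r
  obtain ⟨M, hLip⟩ := exists_lipschitz_bound hD hI t₀ (t₀ + T) R
  have hpast : ∀ m s, u m (t₀ + (s : Iic (0 : ℝ))) = φ m s := fun m s => by
    rw [← (hu m).1]; rfl
  have hinit : ∀ m, ‖u m t₀‖ ≤ r := fun m => by
    have h1 := norm_le_exp_mul_gammaNorm (hφ m).1 ⟨0, le_refl (0 : ℝ)⟩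
    rw [← hpast] at h1
    simp only [mul_zero, neg_zero, Real.exp_zero, one_mul, add_zero] at h1
    exact h1.trans (hφ m).2
  have hbdd := fun m => hR id isShrinking_id (ε m) (u m) (hu m).isFieldSolution (hinit m)
  obtain ⟨ψ, hψ, w₁, hw₁, hunif⟩ := exists_subseq_tendstoUniformlyOn_of_lipschitz h01
    (fun m => hLip (ε m) (u m) (hu m).isFieldSolution (hbdd m)) hbdd
  let w : ℝ → NetState n := fun t =>
    if t ≤ t₀ then φ₀ ⟨min (t - t₀) 0, mem_Iic.2 (min_le_right _ _)⟩ else w₁ t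
  have hwpast : ∀ s : Iic (0 : ℝ), w (t₀ + s) = φ₀ s := fun s => by
    have hs : (s : ℝ) ≤ 0 := s.2
    simp [w, hs]
  have hhist : historyAt w t₀ = φ₀ := funext hwpast
  have hpastlim : ∀ c, TendstoUniformlyOn u w atTop (Icc c t₀) := by
    intro c
    rw [Metric.tendstoUniformlyOn_iff]
    intro δ hδ
    have h1 : Tendsto (fun m => Real.exp (γ * (t₀ - c)) * gammaNorm γ (φ m - φ₀)) atTop (𝓝 0) := by
      simpa using hlim.const_mul (Real.exp (γ * (t₀ - c)))
    filter_upwards [h1.eventually (gt_mem_nhds hδ)] with m hm s hs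
    refine lt_of_le_of_lt ?_ hm
    have hs0 : s - t₀ ≤ 0 := by linarith [hs.2]
    have h2 := norm_le_exp_mul_gammaNorm (CGamma.sub_mem (hφ m).1 hφ₀) ⟨s - t₀, hs0⟩
    rw [Pi.sub_apply, ← hpast, ← hwpast] at h2
    simp only [add_sub_cancel] at h2
    rw [dist_comm, dist_eq_norm]
    refine h2.trans ?_
    have h3 : 0 ≤ gammaNorm γ (φ m - φ₀) :=
      Real.iSup_nonneg fun s => by positivity
    gcongr
    nlinarith [hs.1]
  have hww₁ : EqOn w w₁ (Icc t₀ (t₀ + T)) := by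
    intro t ht
    rcases ht.1.eq_or_lt with rfl | hlt
    · exact tendsto_nhds_unique (((hpastlim t₀).tendsto_at (by simp)).comp hψ.tendsto_atTop)
        (hunif.tendsto_at ht)
    · simp [w, hlt]
  have hwlip : LipschitzOnWith M w (Icc t₀ (t₀ + T)) := fun x hx y hy => by
    rw [hww₁ hx, hww₁ hy]; exact hw₁ hx hy
  have hunif' : TendstoUniformlyOn (fun k => u (ψ k)) w atTop (Icc t₀ (t₀ + T)) :=
    hunif.congr_right hww₁.symm
  have hall : ∀ c, TendstoUniformlyOn (fun k => u (ψ k)) w atTop (Icc c (t₀ + T)) := fun c => by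
    have h1 : TendstoUniformlyOn (fun k => u (ψ k)) w atTop (Icc c t₀) := fun U hU =>
      hψ.tendsto_atTop.eventually (hpastlim c U hU)
    intro U hU
    filter_upwards [h1 U hU, hunif' U hU] with k hk1 hk2 s hs
    rcases le_total s t₀ with h | h
    · exact hk1 s ⟨hs.1, h⟩
    · exact hk2 s ⟨h, hs.2⟩
  have hwc := continuousOn_Iic_of_historyAt h01 hhist hφ₀.1 hwlip.continuousOn
  refine ⟨ψ, hψ, w, hwlip.continuousOn, hunif', hhist, ?_, ?_⟩
  · exact LipschitzOnWith.absolutelyContinuousOnInterval (K := M) (by rwa [uIcc_of_le h01])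
  have hε' : Tendsto (fun k => ε (ψ k)) atTop (𝓝[>] 0) :=
    tendsto_nhdsWithin_iff.2 ⟨hε.comp hψ.tendsto_atTop, Eventually.of_forall fun k => hε0 _⟩
  rw [← restrict_Ioo_eq_restrict_Icc]
  filter_upwards [ae_restrict_of_ae (hwlip.ae_differentiableWithinAt_of_mem (μ := volume)),
    ae_restrict_mem measurableSet_Ioo] with t hdiff ht
  -- the selection of the set-valued term is read off from the derivative of the limit
  have hd : HasDerivAt w (deriv w t) t :=
    ((hdiff (Ioo_subset_Icc_self ht)).differentiableAt (Icc_mem_nhds ht.1 ht.2)).hasDerivAt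
  refine ⟨deriv w t - N.decay (historyAt w t) - N.stimuli t, ?_, ?_⟩
  · rw [mem_chiTerm_iff]
    intro q
    rw [coordL_sub_decay_sub_stimuli, present_historyAt]
    exact coordL_deriv_mem_of_tendsto hD hI hε' ht (fun k => (hu (ψ k)).isFieldSolution)
      (fun k => (hu (ψ k)).continuousOn hT (hφ (ψ k)).1.1) hwc hall hd q
  · have : N.decay (historyAt w t) + (deriv w t - N.decay (historyAt w t) - N.stimuli t)
        + N.stimuli t = deriv w t := by abel
    rwa [this]

/-! ### Existence of sigmoidal solutions -/

/-- The coordinatewise projection of the state space onto the ball of radius `R`. -/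
def clipState (R : ℝ) (v : NetState n) : NetState n :=
  ofCoord fun q => max (-R) (min R (coordL q v))

theorem coordL_clipState (R : ℝ) (v : NetState n) (q : NetCoord n) :
    coordL q (clipState R v) = max (-R) (min R (coordL q v)) := coordL_ofCoord _ q

theorem continuous_clipState (R : ℝ) : Continuous (clipState R : NetState n → NetState n) :=
  continuous_ofCoord.comp (by fun_prop)

theorem isShrinking_clipState {R : ℝ} (hR : 0 ≤ R) :
    IsShrinking (clipState R : NetState n → NetState n) := by
  refine ⟨fun v q => ?_, fun v q => ?_⟩
  · rw [coordL_clipState]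
    grind
  · rw [coordL_clipState]
    rcases le_total 0 (coordL q v) with h | h
    · exact mul_nonneg (le_max_of_le_right (le_min hR h)) h
    · exact mul_nonneg_of_nonpos_of_nonpos
        (max_le (by linarith) ((min_le_right _ _).trans h)) h

theorem abs_coordL_clipState_le {R : ℝ} (hR : 0 ≤ R) (v : NetState n) (q : NetCoord n) :
    |coordL q (clipState R v)| ≤ R := by
  rw [coordL_clipState]; grind

theorem norm_clipState_sub_le (R : ℝ) (v w : NetState n) :
    ‖clipState R v - clipState R w‖ ≤ ‖v - w‖ := by
  refine norm_le_of_abs_coordL_le (norm_nonneg _) fun q => ?_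
  rw [map_sub, coordL_clipState, coordL_clipState]
  refine le_trans ?_ ((map_sub (coordL q) v w) ▸ abs_coordL_le q (v - w))
  grind

theorem clipState_eq_self {R : ℝ} {v : NetState n} (h : ‖v‖ ≤ R) : clipState R v = v := by
  refine ext_coordL fun q => ?_
  have := abs_le.1 ((abs_coordL_le q v).trans h)
  rw [coordL_clipState, min_eq_right this.2, max_eq_right this.1]

theorem abs_sigSignal_sub_le {ε : ℝ} (hε : 0 < ε) {φ χ : NetHistory n} (hφ : Continuous φ)
    (hχ : Continuous χ) {δ : ℝ} (h : ∀ τ, ‖φ τ - χ τ‖ ≤ δ) (p : OffDiag n)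
    [IsFiniteMeasure (N.μ p)] :
    |N.sigSignal ε φ p - N.sigSignal ε χ p| ≤ ε⁻¹ * (N.μ p).real univ * δ := by
  have hint : ∀ {φ : NetHistory n}, Continuous φ →
      Integrable (fun τ => sigmoidFun ε ((φ τ).1 p.1.1 - N.Γ p.1.1)) (N.μ p) := fun hφ =>
    Integrable.of_bound
      ((continuous_sigmoidFun ε).comp (continuous_signal_arg hφ N _)).aestronglyMeasurable 1
      (ae_of_all _ fun _ => norm_sigmoidFun_le_one _ _)
  rw [sigSignal, sigSignal, ← integral_sub (hint hφ) (hint hχ)]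
  rw [mul_right_comm, ← Real.norm_eq_abs]
  refine norm_integral_le_of_norm_le_const (μ := N.μ p) (ae_of_all _ fun τ => ?_)
  refine (abs_sigmoidFun_sub_le hε _ _).trans ?_
  rw [sub_sub_sub_cancel_right]
  gcongr
  exact (abs_coordL_le (.inl p.1.1) (φ τ - χ τ)).trans (h τ)

/-- The truncated right-hand side is globally Lipschitz. -/
theorem exists_field_clipState_lipschitz [∀ p, IsFiniteMeasure (N.μ p)] (hD : N.HypD) {ε : ℝ}
    (hε : 0 < ε) {R : ℝ} (hR : 0 ≤ R) (q : NetCoord n) :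
    ∃ L : ℝ, 0 ≤ L ∧ ∀ t, ∀ φ χ : NetHistory n, Continuous φ → Continuous χ → ∀ δ,
      (∀ τ, ‖φ τ - χ τ‖ ≤ δ) →
        |N.field (clipState R) ε t φ q - N.field (clipState R) ε t χ q| ≤ L * δ := by
  obtain ⟨C, hC, hwl, hwb⟩ := N.exists_weight_lipschitz
  obtain ⟨K, hK⟩ := LocallyLipschitzOn.exists_lipschitzOnWith_of_compact
    (isCompact_Icc (a := -R) (b := R)) (hD.locallyLipschitz_rate q).locallyLipschitzOn
  obtain ⟨S, hS⟩ := (isCompact_Icc (a := -R) (b := R)).exists_bound_of_continuousOn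
    (hD.locallyLipschitz_rate q).continuous.continuousOn
  have hS0 : 0 ≤ S := (norm_nonneg _).trans (hS 0 ⟨by linarith, hR⟩)
  refine ⟨(S + R * K) + ∑ k : Input q, (C * (1 + R) * (ε⁻¹ * (N.μ k.pair).real univ)
    + (N.μ k.pair).real univ * C), by positivity, fun t φ χ hφ hχ δ h => ?_⟩
  set a := clipState R (present φ) with ha
  set b := clipState R (present χ) with hb
  have hab : ‖a - b‖ ≤ δ := (norm_clipState_sub_le R _ _).trans (h _)
  have hδ : 0 ≤ δ := (norm_nonneg _).trans hab
  have hqab : |coordL q a - coordL q b| ≤ δ := by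
    rw [← map_sub]; exact (abs_coordL_le q _).trans hab
  have haR : ‖a‖ ≤ R := norm_le_of_abs_coordL_le hR (abs_coordL_clipState_le hR _)
  have hbR : |coordL q b| ≤ R := abs_coordL_clipState_le hR _ q
  have hma : coordL q a ∈ Icc (-R) R := abs_le.1 (abs_coordL_clipState_le hR _ q)
  have hmb : coordL q b ∈ Icc (-R) R := abs_le.1 hbR
  have hdec : |N.rate q (coordL q a) * coordL q a - N.rate q (coordL q b) * coordL q b|
      ≤ (S + R * K) * δ := by
    have h1 : |N.rate q (coordL q a) - N.rate q (coordL q b)| ≤ K * δ :=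
      (hK.dist_le_mul _ hma _ hmb).trans (by gcongr; exact hqab)
    calc _ = |N.rate q (coordL q a) * (coordL q a - coordL q b)
          + coordL q b * (N.rate q (coordL q a) - N.rate q (coordL q b))| := by congr 1; ring
      _ ≤ S * δ + R * (K * δ) := by
        refine (abs_add_le _ _).trans (add_le_add ?_ ?_)
        · rw [abs_mul]; exact mul_le_mul (hS _ hma) hqab (abs_nonneg _) hS0
        · rw [abs_mul]; exact mul_le_mul hbR h1 (abs_nonneg _) hR
      _ = _ := by ring
  have hterm : ∀ k : Input q,
      |N.weight k a * N.sigSignal ε φ k.pair - N.weight k b * N.sigSignal ε χ k.pair|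
        ≤ (C * (1 + R) * (ε⁻¹ * (N.μ k.pair).real univ) + (N.μ k.pair).real univ * C) * δ := by
    intro k
    have h1 : |N.weight k a| ≤ C * (1 + R) := (hwb q k a).trans (by gcongr)
    have h2 : |N.weight k a - N.weight k b| ≤ C * δ := (hwl q k a b).trans (by gcongr)
    have h3 := N.abs_sigSignal_sub_le hε hφ hχ h k.pair
    calc _ = |N.weight k a * (N.sigSignal ε φ k.pair - N.sigSignal ε χ k.pair)
          + N.sigSignal ε χ k.pair * (N.weight k a - N.weight k b)| := by congr 1; ring
      _ ≤ C * (1 + R) * (ε⁻¹ * (N.μ k.pair).real univ * δ)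
          + (N.μ k.pair).real univ * (C * δ) := by
        refine (abs_add_le _ _).trans (add_le_add ?_ ?_)
        · rw [abs_mul]; exact mul_le_mul h1 h3 (abs_nonneg _) (by positivity)
        · rw [abs_mul]
          exact mul_le_mul (N.abs_sigSignal_le ε χ _) h2 (abs_nonneg _) (by positivity)
      _ = _ := by ring
  have hsum : |∑ k : Input q, N.weight k a * N.sigSignal ε φ k.pair
      - ∑ k : Input q, N.weight k b * N.sigSignal ε χ k.pair| ≤
      (∑ k : Input q, (C * (1 + R) * (ε⁻¹ * (N.μ k.pair).real univ)
        + (N.μ k.pair).real univ * C)) * δ := by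
    rw [← Finset.sum_sub_distrib, Finset.sum_mul]
    exact (Finset.abs_sum_le_sum_abs _ _).trans (Finset.sum_le_sum fun k _ => hterm k)
  rw [field, field, inflow, inflow, ← ha, ← hb, add_mul]
  rw [abs_le] at hdec hsum ⊢
  constructor <;> linarith [hdec.1, hdec.2, hsum.1, hsum.2]

theorem continuous_field [∀ p, IsFiniteMeasure (N.μ p)] (hD : N.HypD) (hI : N.HypI) (ε : ℝ)
    {ρ : NetState n → NetState n} (hρ : Continuous ρ) {u : ℝ → NetState n} (hu : Continuous u)
    (q : NetCoord n) : Continuous fun t => N.field ρ ε t (historyAt u t) q := by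
  have hs : ∀ p, Continuous fun t => N.sigSignal ε (historyAt u t) p := fun p => by
    refine continuous_of_dominated (bound := fun _ => 1) (fun t => ?_)
      (fun t => ae_of_all _ fun τ => norm_sigmoidFun_le_one _ _) (integrable_const _)
      (ae_of_all _ fun τ => ?_)
    · exact ((continuous_sigmoidFun ε).comp (continuous_signal_arg
        (continuous_historyAt hu.continuousOn) N _)).aestronglyMeasurable
    · have : Continuous fun t => historyAt u t τ := hu.comp (continuous_id.add continuous_const)
      exact (continuous_sigmoidFun ε).comp (by fun_prop)
  have hq : Continuous fun t => coordL q (ρ (u t)) := (coordL q).continuous.comp (hρ.comp hu)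
  simp only [field, inflow, present_historyAt]
  refine (((hD.locallyLipschitz_rate q).continuous.comp hq).neg.mul hq).add
    ((continuous_finsetSum _ fun k _ => ?_).add (hI.continuous_stim q))
  exact ((N.continuous_weight k).comp (hρ.comp hu)).mul (hs _)

/-- Existence for the sigmoidal system: Picard's theorem gives a solution of the system truncated at
the radius of the a priori bound, and this bound shows that the truncation is not active. -/
theorem exists_isSigmoidalSolution [∀ p, IsFiniteMeasure (N.μ p)] (hD : N.HypD) (hI : N.HypI)
    {ε : ℝ} (hε : 0 < ε) {t₀ T : ℝ} (hT : 0 < T) {φ : NetHistory n} (hφ : Continuous φ) :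
    ∃ u, N.IsSigmoidalSolution ε t₀ T φ u := by
  have h01 : t₀ ≤ t₀ + T := by linarith
  obtain ⟨R, hR0, hR⟩ := exists_apriori_bound hD hI t₀ (t₀ + T) ‖present φ‖
  choose L hL0 hL using fun q => exists_field_clipState_lipschitz hD hε hR0 q
  obtain ⟨u, huc, hup, hud⟩ := exists_solution_of_lipschitz_functional h01
    (F := fun t u => ofCoord (N.field (clipState R) ε t (historyAt u t))) (L := ∑ q, L q)
    (Finset.sum_nonneg fun q _ => hL0 q)
    (fun u hu => continuous_ofCoord.comp
      (continuous_pi fun q => continuous_field hD hI ε (continuous_clipState R) hu q))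
    (fun s _ u v hu hv δ hδ => by
      have hδ0 : 0 ≤ δ := (norm_nonneg _).trans (hδ s le_rfl)
      refine norm_le_of_abs_coordL_le
        (mul_nonneg (Finset.sum_nonneg fun q _ => hL0 q) hδ0) fun q => ?_
      rw [map_sub, coordL_ofCoord, coordL_ofCoord]
      refine (hL q s _ _ (continuous_historyAt hu.continuousOn)
        (continuous_historyAt hv.continuousOn) δ fun τ => hδ _ ?_).trans ?_
      · have := mem_Iic.1 τ.2; linarith
      · gcongr
        exact Finset.single_le_sum (fun q _ => hL0 q) (Finset.mem_univ q))
    (φ := fun t => φ ⟨min (t - t₀) 0, mem_Iic.2 (min_le_right _ _)⟩)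
    (hφ.comp (Continuous.subtype_mk (by fun_prop) _))
  have hhist : historyAt u t₀ = φ := by
    funext s
    have hs : (s : ℝ) ≤ 0 := s.2
    rw [historyAt, hup _ (by linarith)]
    simp [hs]
  have hac : AbsolutelyContinuousOnInterval u t₀ (t₀ + T) := by
    have hcont : Continuous fun t => ofCoord (N.field (clipState R) ε t (historyAt u t)) :=
      continuous_ofCoord.comp
        (continuous_pi fun q => continuous_field hD hI ε (continuous_clipState R) huc q)
    obtain ⟨B, hB⟩ := (isCompact_Icc (a := t₀) (b := t₀ + T)).exists_bound_of_continuousOn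
      hcont.continuousOn
    refine LipschitzOnWith.absolutelyContinuousOnInterval (K := B.toNNReal) ?_
    rw [uIcc_of_le h01]
    refine (convex_Icc _ _).lipschitzOnWith_of_nnnorm_hasDerivWithin_le hud fun t ht => ?_
    rw [← NNReal.coe_le_coe, coe_nnnorm]
    exact (hB t ht).trans (Real.le_coe_toNNReal B)
  have hder : ∀ t ∈ Ioo t₀ (t₀ + T),
      HasDerivAt u (ofCoord (N.field (clipState R) ε t (historyAt u t))) t := fun t ht =>
    (hud t (Ioo_subset_Icc_self ht)).hasDerivAt (Icc_mem_nhds ht.1 ht.2)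
  have hfield : N.IsFieldSolution (clipState R) ε t₀ (t₀ + T) u := by
    refine ⟨hac, ?_⟩
    rw [← restrict_Ioo_eq_restrict_Icc]
    filter_upwards [ae_restrict_mem measurableSet_Ioo] with t ht q
    have := (hder t ht).coordL q
    rwa [coordL_ofCoord] at this
  have hbound := hR _ (isShrinking_clipState hR0) ε u hfield (by
    rw [← present_historyAt u t₀, hhist])
  refine ⟨u, hhist, hac, ?_⟩
  rw [← restrict_Ioo_eq_restrict_Icc]
  filter_upwards [ae_restrict_mem measurableSet_Ioo] with t ht
  convert! hder t ht using 1
  refine ext_coordL fun q => ?_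
  rw [coordL_rhs, coordL_ofCoord, field, field, present_historyAt,
    clipState_eq_self (hbound t (Ioo_subset_Icc_self ht)), id]

end NeuralNet

theorem mainTheorem2 (n : ℕ) (N : NeuralNet n) (γ : ℝ) (hγ : 0 < γ)
    (hD : N.HypD) (hM : N.HypM γ) (hI : N.HypI) (t₀ T : ℝ) (hT : 0 < T) :
    -- convergence, along a subsequence, to a solution of the Heaviside inclusion
    (∀ (r : ℝ), 0 < r →
      ∀ (ε : ℕ → ℝ), (∀ m, ε m ∈ Ioc (0 : ℝ) (1 / 5)) → Antitone ε → Tendsto ε atTop (𝓝 0) →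
      ∀ (φ : ℕ → NetHistory n) (φ₀ : NetHistory n),
        (∀ m, φ m ∈ CGamma n γ ∧ gammaNorm γ (φ m) ≤ r) → φ₀ ∈ CGamma n γ →
        Tendsto (fun m => gammaNorm γ (φ m - φ₀)) atTop (𝓝 0) →
      ∀ (u : ℕ → ℝ → NetState n),
        (∀ m, N.IsSigmoidalSolution (ε m) t₀ T (φ m) (u m)) →
        ∃ ψ : ℕ → ℕ, StrictMono ψ ∧ ∃ uStar : ℝ → NetState n,
          ContinuousOn uStar (Icc t₀ (t₀ + T)) ∧
          TendstoUniformlyOn (fun k => u (ψ k)) uStar atTop (Icc t₀ (t₀ + T)) ∧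
          N.IsInflatedSolution 0 t₀ T φ₀ uStar) ∧
    -- solutions of the sigmoidal system solve the inflated inclusion
    (∀ ε ∈ Ioc (0 : ℝ) (1 / 5), ∀ φ ∈ CGamma n γ, ∀ u : ℝ → NetState n,
      N.IsSigmoidalSolution ε t₀ T φ u → N.IsInflatedSolution ε t₀ T φ u) ∧
    -- existence of solutions of the Heaviside inclusion
    (∀ φ₀ ∈ CGamma n γ, ∃ u : ℝ → NetState n, N.IsInflatedSolution 0 t₀ T φ₀ u) := by
  have := fun p => hM.isFiniteMeasure hγ p
  refine ⟨fun r _ ε hε _ hε0 φ φ₀ hφ hφ₀ hlim u hu =>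
      NeuralNet.exists_subseq_tendsto_heaviside hγ hD hM hI hT (fun m => (hε m).1) hε0 hφ hφ₀
        hlim hu,
    fun ε hε φ hφ u hu => hu.isInflatedSolution hε.1 (by linarith [hε.2]) hT hφ.1,
    fun φ₀ hφ₀ => ?_⟩
  choose u hu using fun m : ℕ => NeuralNet.exists_isSigmoidalSolution hD hI
    (show (0 : ℝ) < 1 / ((m : ℝ) + 1) by positivity) (t₀ := t₀) hT hφ₀.1
  obtain ⟨-, -, w, -, -, hw⟩ := NeuralNet.exists_subseq_tendsto_heaviside hγ hD hM hI hT
    (fun m => by positivity) tendsto_one_div_add_atTop_nhds_zero_nat (fun _ => ⟨hφ₀, le_rfl⟩) hφ₀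
    (by simp [gammaNorm]) hu
  exact ⟨w, hw⟩
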